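/- Conventions: $\mathcal H^1$ is the one-dimensional Hausdorff measure, $B(x,r)$ is the closed ball, $\operatorname{diam}$ of an unbounded set is $\infty$, a direction is a line $V\subset\mathbb R^2$ through the origin, and for $x\in\mathbb R^2$, a direction $V$, $\alpha\in(0,\pi/2)$ and $r>0$, $$K(x,V,\alpha,r)=\{y\in B(x,r):\operatorname{dist}(y,V+x)<\sin(\alpha)\,|y-x|\}.$$ For a measure $\mu$ on $\mathbb R^2$ and $1\le p<\infty$ let $$\mathcal E_{\mu,p}(x,V,\alpha,R)=\int_0^R\Big(\frac{\mu(K(x,V,\alpha,r))}{r}\Big)^p\,\frac{dr}{r}.$$ - An $\mathcal H^1$-measurable set $E\subset\mathbb R^2$ is *1-Ahlfors–David regular* if there is $C>0$ with $C^{-1}r\le\mathcal H^1(E\cap B(x,r))\le Cr$ for all $x\in E$ and $0<r<\operatorname{diam}E$. - $E$ *has big pieces of 1-Lipschitz graphs* if there is $\kappa>0$ such that for all $x\in E$ and $0<r<\operatorname{diam}E$ there is a graph $\Gamma=\{v+f(v):v\in L\}$ of a 1-Lipschitz function $f:L\to L^\perp$ over some line $L$ through the origin with $\mathcal H^1(E\cap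 B(x,r)\cap\Gamma)\ge\kappa r$. - $\mu$ *has big pieces of bounded energy*, BPBE($p$), if there are $\alpha\in(0,\pi/2)$ and $\kappa,M_0>0$ such that for all balls $B=B(z,r)$ with $z\in\operatorname{supp}\mu$, $0<r<\operatorname{diam}(\operatorname{supp}\mu)$, there are a set $G_B\subset B$ with $\mu(G_B)\ge\kappa\mu(B)$ and a direction $V_B$ such that $\mathcal E_{\mu,p}(x,V_B,\alpha,r)\le M_0$ for all $x\in G_B$. - $\mu$ *has bounded mean energy*, BME($p$), if there are $\alpha\in(0,\pi/2)$, $M_0>0$ and, for every $x\in\operatorname{supp}\mu$, a direction $V_x$, such that for all balls $B=B(z,r)$ with $z\in\operatorname{supp}\mu$, $0<r<\operatorname{diam}(\operatorname{supp}\mu)$, $$\int_B\mathcal E_{\mu,p}(x,V_x,\alpha,r)\,d\mu(x)\le M_0\,\mu(B).$$ No measurability of $x\mapsto V_x$ is required; the integral over $B$ is the lower integral. **Theorem.** There exists a 1-Ahlfors–David regular set $E\subset\mathbb R^2$ that has big pieces of 1-Lipschitz graphs and such that, for every real $p\ge1$, the measure $\mathcal H^1|_E$ satisfies BPBE($p$)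 but does not satisfy BME($p$). In particular, BPBE($p$) does not imply BME($p$) for any $p\ge1$. -/

import Mathlib

open MeasureTheory Set
open scoped ENNReal NNReal

/-- The restriction of the `n`-dimensional Hausdorff measure to a subset `E` of `ℝ^d`. -/
noncomputable def hausdorffOn {d : ℕ} (n : ℕ) (E : Set (EuclideanSpace ℝ (Fin d))) :
    Measure (EuclideanSpace ℝ (Fin d)) :=
  (Measure.hausdorffMeasure (n : ℝ)).restrict E

/-- `E` is `n`-Ahlfors-David regular: `E` is measurable (in the sense of Carathéodory) for the
`n`-dimensional Hausdorff measure, and `C⁻¹ r ^ n ≤ ℋⁿ(E ∩ B(x,r)) ≤ C r ^ n` for all `x ∈ E` and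
`0 < r < diam E`, where `diam E` is infinite if `E` is unbounded. -/
def IsADRSet {d : ℕ} (n : ℕ) (E : Set (EuclideanSpace ℝ (Fin d))) : Prop :=
  (Measure.hausdorffMeasure (n : ℝ) :
    Measure (EuclideanSpace ℝ (Fin d))).toOuterMeasure.IsCaratheodory E ∧
  ∃ C : ℝ, 0 < C ∧ ∀ x ∈ E, ∀ r : ℝ, 0 < r → ENNReal.ofReal r < Metric.ediam E →
    ENNReal.ofReal (C⁻¹ * r ^ n) ≤ hausdorffOn n E (Metric.closedBall x r) ∧
    hausdorffOn n E (Metric.closedBall x r) ≤ ENNReal.ofReal (C * r ^ n)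

/-- `Γ` is the graph `{v + f v : v ∈ V}` of an `L`-Lipschitz map `f : V → Vᗮ` over some
`n`-dimensional linear subspace `V` of `ℝ^d`. -/
def IsLipschitzGraph {d : ℕ} (n : ℕ) (L : ℝ≥0) (Γ : Set (EuclideanSpace ℝ (Fin d))) : Prop :=
  ∃ V : Submodule ℝ (EuclideanSpace ℝ (Fin d)), Module.finrank ℝ V = n ∧
    ∃ f : V → Vᗮ, LipschitzWith L f ∧
      Γ = range fun v : V => (v : EuclideanSpace ℝ (Fin d)) + (f v : EuclideanSpace ℝ (Fin d))

/-- `E` has big pieces of `L`-Lipschitz graphs (of dimension `n`). -/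
def HasBPLG {d : ℕ} (n : ℕ) (L : ℝ≥0) (E : Set (EuclideanSpace ℝ (Fin d))) : Prop :=
  ∃ κ : ℝ, 0 < κ ∧ ∀ x ∈ E, ∀ r : ℝ, 0 < r → ENNReal.ofReal r < Metric.ediam E →
    ∃ Γ : Set (EuclideanSpace ℝ (Fin d)), IsLipschitzGraph n L Γ ∧
      ENNReal.ofReal (κ * r ^ n) ≤
        Measure.hausdorffMeasure (n : ℝ) (E ∩ Metric.closedBall x r ∩ Γ)

/-- The open cone `K(x,V,α)` with vertex `x`, direction `V` and aperture `α`. -/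
def cone {d : ℕ} (x : EuclideanSpace ℝ (Fin d)) (V : Submodule ℝ (EuclideanSpace ℝ (Fin d)))
    (α : ℝ) : Set (EuclideanSpace ℝ (Fin d)) :=
  {y | Metric.infDist y ((fun v => v + x) '' (V : Set (EuclideanSpace ℝ (Fin d)))) <
    Real.sin α * dist y x}

/-- The truncated cone `K(x,V,α,r) = K(x,V,α) ∩ B(x,r)`. -/
def truncatedCone {d : ℕ} (x : EuclideanSpace ℝ (Fin d))
    (V : Submodule ℝ (EuclideanSpace ℝ (Fin d))) (α r : ℝ) : Set (EuclideanSpace ℝ (Fin d)) :=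
  cone x V α ∩ Metric.closedBall x r

/-- The `n`-dimensional `(V,α,p)`-conical energy of `μ` at `x` up to scale `R`, with values in
`[0,∞]`: the integral over `0 < r ≤ R` of `(μ(K(x,V,α,r)) / r ^ n) ^ p` with respect to `dr / r`. -/
noncomputable def conicalEnergy {d : ℕ} (n : ℕ) (p : ℝ) (μ : Measure (EuclideanSpace ℝ (Fin d)))
    (x : EuclideanSpace ℝ (Fin d)) (V : Submodule ℝ (EuclideanSpace ℝ (Fin d)))
    (α R : ℝ) : ℝ≥0∞ :=
  ∫⁻ r in Ioc (0 : ℝ) R,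
    (μ (truncatedCone x V α r) / ENNReal.ofReal r ^ n) ^ p / ENNReal.ofReal r

/-- `μ` has big pieces of bounded energy for `p`. Directions are the `(d - n)`-dimensional linear
subspaces of `ℝ^d`. -/
def HasBPBE {d : ℕ} (n : ℕ) (p : ℝ) (μ : Measure (EuclideanSpace ℝ (Fin d))) : Prop :=
  ∃ α κ M₀ : ℝ, 0 < α ∧ α < Real.pi / 2 ∧ 0 < κ ∧ 0 < M₀ ∧
    ∀ z ∈ μ.support, ∀ r : ℝ, 0 < r → ENNReal.ofReal r < Metric.ediam μ.support →
      ∃ G ⊆ Metric.closedBall z r, ENNReal.ofReal κ * μ (Metric.closedBall z r) ≤ μ G ∧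
        ∃ V : Submodule ℝ (EuclideanSpace ℝ (Fin d)), Module.finrank ℝ V + n = d ∧
          ∀ x ∈ G, conicalEnergy n p μ x V α r ≤ ENNReal.ofReal M₀

/-- `μ` has bounded mean energy for `p`. The directions `V x` may depend on `x` in any way. As no
measurability of `x ↦ V x` is asked for, the outer integral is the lower integral, so that the
condition is the most permissive one. -/
def HasBME {d : ℕ} (n : ℕ) (p : ℝ) (μ : Measure (EuclideanSpace ℝ (Fin d))) : Prop :=
  ∃ α M₀ : ℝ, 0 < α ∧ α < Real.pi / 2 ∧ 0 < M₀ ∧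
    ∃ V : EuclideanSpace ℝ (Fin d) → Submodule ℝ (EuclideanSpace ℝ (Fin d)),
      (∀ x ∈ μ.support, Module.finrank ℝ (V x) + n = d) ∧
      ∀ z ∈ μ.support, ∀ r : ℝ, 0 < r → ENNReal.ofReal r < Metric.ediam μ.support →
        ∫⁻ x in Metric.closedBall z r, conicalEnergy n p μ x (V x) α r ∂μ ≤
          ENNReal.ofReal M₀ * μ (Metric.closedBall z r)

/-! The set is a self-similar-like union. A segment of half-length one carries a row of about `2 N`
tiny copies of the next-generation set, spaced by `1 / N`, hovering at height about `1 / (2 N)` and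
scaled by `1 / (20 N)`. Each generation has its own direction and its own `N`.

Positive side: every ball centred on the set contains a piece of a generating segment of comparable
size (`hasFlatPiece_limitSet`), which gives regularity from below and big pieces of lines. From such
a piece, the narrow cone orthogonal to the segment misses the segment and meets the hovering row
only at distances comparable to `1 / N`. Only boundedly many dyadic scales count, so the energy is
bounded however large `N` is (`conicalEnergy_le`).

Negative side: the generation `100 j` part has mass at least `2 * 10 ^ (-100 j)`, and each of its
points has an ancestor segment in every earlier generation. The directions `√i`, `j ≤ i < 100 j`,
are `O(1 / √j)`-dense in the circle, so any direction at such a point is almost parallel to some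
ancestor segment (`exists_sqrt_near`). The cone then sees that segment over a range of scales of
ratio about `N i`, which costs energy of order `log (N i)` (`le_conicalEnergy_of_mem_deepPart`). The
numbers `N i` are so large that this logarithm beats the mass decay by a factor `j + 1`, and no
choice of directions keeps the mean bounded. -/

/-! ### Orthonormal frames of the plane -/

/-- The unit vector of the plane with argument `θ`. -/
noncomputable def dir (θ : ℝ) : EuclideanSpace ℝ (Fin 2) := !₂[Real.cos θ, Real.sin θ]

/-- The unit vector `dir θ`, turned by a right angle. -/
noncomputable def nrm (θ : ℝ) : EuclideanSpace ℝ (Fin 2) := !₂[-Real.sin θ, Real.cos θ]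

lemma norm_dir (θ : ℝ) : ‖dir θ‖ = 1 := by
  simp [dir, EuclideanSpace.norm_eq]

lemma norm_nrm (θ : ℝ) : ‖nrm θ‖ = 1 := by
  simp [nrm, EuclideanSpace.norm_eq]

lemma inner_dir_dir (θ : ℝ) : inner ℝ (dir θ) (dir θ) = 1 := by
  rw [real_inner_self_eq_norm_sq, norm_dir, one_pow]

lemma inner_nrm_nrm (θ : ℝ) : inner ℝ (nrm θ) (nrm θ) = 1 := by
  rw [real_inner_self_eq_norm_sq, norm_nrm, one_pow]

lemma inner_dir_nrm (θ : ℝ) : inner ℝ (dir θ) (nrm θ) = 0 := by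
  simp [dir, nrm, PiLp.inner_apply, Fin.sum_univ_two]
  ring

lemma inner_nrm_dir (θ : ℝ) : inner ℝ (nrm θ) (dir θ) = 0 := by
  rw [real_inner_comm, inner_dir_nrm]

lemma abs_inner_dir_le (θ : ℝ) (y : EuclideanSpace ℝ (Fin 2)) : |inner ℝ (dir θ) y| ≤ ‖y‖ := by
  simpa [norm_dir] using abs_real_inner_le_norm (dir θ) y

lemma abs_inner_nrm_le (θ : ℝ) (y : EuclideanSpace ℝ (Fin 2)) : |inner ℝ (nrm θ) y| ≤ ‖y‖ := by
  simpa [norm_nrm] using abs_real_inner_le_norm (nrm θ) y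

lemma eq_inner_dir_add_inner_nrm (θ : ℝ) (y : EuclideanSpace ℝ (Fin 2)) :
    y = (inner ℝ (dir θ) y : ℝ) • dir θ + (inner ℝ (nrm θ) y : ℝ) • nrm θ := by
  have h := Real.cos_sq_add_sin_sq θ
  ext i
  fin_cases i <;> simp [dir, nrm, PiLp.inner_apply, Fin.sum_univ_two]
  · linear_combination (-(y 0)) * h
  · linear_combination (-(y 1)) * h

lemma norm_le_abs_inner_add (θ : ℝ) (y : EuclideanSpace ℝ (Fin 2)) :
    ‖y‖ ≤ |inner ℝ (dir θ) y| + |inner ℝ (nrm θ) y| := by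
  conv_lhs => rw [eq_inner_dir_add_inner_nrm θ y]
  refine (norm_add_le _ _).trans ?_
  simp [norm_smul, norm_dir, norm_nrm]

lemma exists_dir_eq {v : EuclideanSpace ℝ (Fin 2)} (hv : ‖v‖ = 1) : ∃ φ : ℝ, v = dir φ := by
  have h1 : v 0 ^ 2 + v 1 ^ 2 = 1 := by
    have := EuclideanSpace.norm_sq_eq v
    simpa [hv, Fin.sum_univ_two] using this.symm
  have h2 : ‖(⟨v 0, v 1⟩ : ℂ)‖ = 1 := by
    rw [Complex.norm_def, Complex.normSq_mk, Real.sqrt_eq_one]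
    linarith
  obtain ⟨φ, hφ⟩ := (Complex.norm_eq_one_iff _).1 h2
  have hr := congrArg Complex.re hφ
  have hi := congrArg Complex.im hφ
  simp only [Complex.exp_ofReal_mul_I_re, Complex.exp_ofReal_mul_I_im] at hr hi
  refine ⟨φ, ?_⟩
  ext i
  fin_cases i <;> simp [dir, hr, hi]

lemma norm_dir_sub_dir_le (s t : ℝ) : ‖dir s - dir t‖ ≤ 2 * |s - t| := by
  have hc : |Real.cos s - Real.cos t| ≤ |s - t| := Real.abs_cos_sub_cos_le s t
  have hs : |Real.sin s - Real.sin t| ≤ |s - t| := Real.abs_sin_sub_sin_le s t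
  have h := norm_le_abs_inner_add 0 (dir s - dir t)
  simp [dir, nrm, PiLp.inner_apply, Fin.sum_univ_two] at h
  simp only [dir]
  linarith

/-! ### Homotheties, lines and segments -/

/-- The image of `F` under the homothety `x ↦ a + σ • x`. -/
def dilate (a : EuclideanSpace ℝ (Fin 2)) (σ : ℝ) (F : Set (EuclideanSpace ℝ (Fin 2))) :
    Set (EuclideanSpace ℝ (Fin 2)) :=
  (fun x => a + σ • x) '' F

lemma dilate_mono {a : EuclideanSpace ℝ (Fin 2)} {σ : ℝ} {F G : Set (EuclideanSpace ℝ (Fin 2))}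
    (h : F ⊆ G) : dilate a σ F ⊆ dilate a σ G :=
  image_mono h

lemma dilate_dilate (a b : EuclideanSpace ℝ (Fin 2)) (σ τ : ℝ)
    (F : Set (EuclideanSpace ℝ (Fin 2))) :
    dilate a σ (dilate b τ F) = dilate (a + σ • b) (σ * τ) F := by
  simp only [dilate, image_image]
  congr 1
  ext1 x
  rw [smul_add, smul_smul, add_assoc]

lemma isCompact_dilate {a : EuclideanSpace ℝ (Fin 2)} {σ : ℝ}
    {F : Set (EuclideanSpace ℝ (Fin 2))} (h : IsCompact F) : IsCompact (dilate a σ F) :=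
  h.image (by fun_prop)

lemma dist_dilate (a x y : EuclideanSpace ℝ (Fin 2)) {σ : ℝ} (hσ : 0 < σ) :
    dist (a + σ • x) (a + σ • y) = σ * dist x y := by
  rw [dist_add_left, dist_smul₀, Real.norm_of_nonneg hσ.le]

open scoped Pointwise in
lemma hausdorffMeasure_dilate (a : EuclideanSpace ℝ (Fin 2)) {σ : ℝ} (hσ : 0 < σ)
    (F : Set (EuclideanSpace ℝ (Fin 2))) :
    μH[1] (dilate a σ F) = ENNReal.ofReal σ * μH[1] F := by
  have h : dilate a σ F = (fun x => a + x) '' (σ • F) := by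
    simp only [dilate, ← image_smul, image_image]
  rw [h, (isometry_add_left a).hausdorffMeasure_image (Or.inl zero_le_one),
    Measure.hausdorffMeasure_smul₀ zero_le_one hσ.ne']
  simp only [NNReal.rpow_one, ENNReal.smul_def, smul_eq_mul]
  congr 1
  rw [← enorm_eq_nnnorm, Real.enorm_of_nonneg hσ.le]

lemma dilate_inter_closedBall_subset (a x : EuclideanSpace ℝ (Fin 2)) {σ : ℝ} (hσ : 0 < σ)
    (r : ℝ) (F : Set (EuclideanSpace ℝ (Fin 2))) :
    dilate a σ F ∩ Metric.closedBall x r ⊆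
      dilate a σ (F ∩ Metric.closedBall (σ⁻¹ • (x - a)) (r / σ)) := by
  rintro _ ⟨⟨y, hy, rfl⟩, hr⟩
  refine ⟨y, ⟨hy, ?_⟩, rfl⟩
  have hx : x = a + σ • (σ⁻¹ • (x - a)) := by rw [smul_inv_smul₀ hσ.ne']; abel
  rw [Metric.mem_closedBall, hx, dist_dilate _ _ _ hσ] at hr
  rw [Metric.mem_closedBall, le_div_iff₀ hσ]
  linarith

lemma isometry_line (a : EuclideanSpace ℝ (Fin 2)) (θ : ℝ) :
    Isometry fun t : ℝ => a + t • dir θ :=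
  Isometry.of_dist_eq fun s t => by
    rw [dist_add_left, dist_eq_norm, ← sub_smul, norm_smul, norm_dir, mul_one, Real.dist_eq,
      Real.norm_eq_abs]

lemma hausdorffMeasure_line (a : EuclideanSpace ℝ (Fin 2)) (θ : ℝ) (s : Set ℝ) :
    μH[1] ((fun t : ℝ => a + t • dir θ) '' s) = volume s := by
  rw [(isometry_line a θ).hausdorffMeasure_image (Or.inl zero_le_one), hausdorffMeasure_real]

/-- The segment of length two and direction `dir θ` centred at the origin. -/
def seg (θ : ℝ) : Set (EuclideanSpace ℝ (Fin 2)) :=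
  (fun t : ℝ => t • dir θ) '' Icc (-1) 1

lemma isCompact_seg (θ : ℝ) : IsCompact (seg θ) :=
  isCompact_Icc.image (by fun_prop)

lemma hausdorffMeasure_seg (θ : ℝ) : μH[1] (seg θ) = 2 := by
  have h := hausdorffMeasure_line 0 θ (Icc (-1) 1)
  simp only [zero_add] at h
  rw [seg, h, Real.volume_Icc]
  norm_num

lemma hausdorffMeasure_seg_inter_closedBall_le (θ : ℝ) (x : EuclideanSpace ℝ (Fin 2)) (r : ℝ) :
    μH[1] (seg θ ∩ Metric.closedBall x r) ≤ ENNReal.ofReal (2 * r) := by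
  have h : seg θ ∩ Metric.closedBall x r ⊆ (fun t : ℝ => 0 + t • dir θ) ''
      Icc (inner ℝ (dir θ) x - r) (inner ℝ (dir θ) x + r) := by
    rintro _ ⟨⟨t, -, rfl⟩, hr⟩
    refine ⟨t, ?_, by simp⟩
    have h1 := (abs_inner_dir_le θ (t • dir θ - x)).trans
      ((dist_eq_norm _ _).symm.le.trans (Metric.mem_closedBall.1 hr))
    rw [inner_sub_right, inner_smul_right, inner_dir_dir, mul_one, abs_le] at h1
    constructor <;> linarith
  refine (measure_mono h).trans ?_
  rw [hausdorffMeasure_line, Real.volume_Icc]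
  exact ENNReal.ofReal_le_ofReal (by linarith)

/-! ### One step of the construction: geometry and separation -/

/-- The centre of the `n`-th copy in `comb θ N F`. -/
noncomputable def ctr (θ : ℝ) (N : ℕ) (n : ℤ) : EuclideanSpace ℝ (Fin 2) :=
  (N : ℝ)⁻¹ • ((n : ℝ) • dir θ + (1 / 2 : ℝ) • nrm θ)

/-- The `n`-th copy of `F` in `comb θ N F`. -/
noncomputable def copy (θ : ℝ) (N : ℕ) (F : Set (EuclideanSpace ℝ (Fin 2))) (n : ℤ) :
    Set (EuclideanSpace ℝ (Fin 2)) :=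
  dilate (ctr θ N n) ((N : ℝ)⁻¹ / 20) F

/-- The segment `seg θ`, with `2 * N + 1` small copies of `F` placed next to it. -/
noncomputable def comb (θ : ℝ) (N : ℕ) (F : Set (EuclideanSpace ℝ (Fin 2))) :
    Set (EuclideanSpace ℝ (Fin 2)) :=
  seg θ ∪ ⋃ n ∈ Finset.Icc (-(N : ℤ)) N, copy θ N F n

lemma seg_subset_comb {θ : ℝ} {N : ℕ} {F : Set (EuclideanSpace ℝ (Fin 2))} :
    seg θ ⊆ comb θ N F :=
  subset_union_left

lemma copy_subset_comb {θ : ℝ} {N : ℕ} {F : Set (EuclideanSpace ℝ (Fin 2))} {n : ℤ}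
    (hn : n ∈ Finset.Icc (-(N : ℤ)) N) : copy θ N F n ⊆ comb θ N F :=
  subset_union_of_subset_right (subset_biUnion_of_mem (u := fun n => copy θ N F n) hn) _

lemma comb_mono {θ : ℝ} {N : ℕ} {F G : Set (EuclideanSpace ℝ (Fin 2))} (h : F ⊆ G) :
    comb θ N F ⊆ comb θ N G :=
  union_subset_union_right _ (iUnion₂_mono fun _ _ => dilate_mono h)

lemma isCompact_comb {θ : ℝ} {N : ℕ} {F : Set (EuclideanSpace ℝ (Fin 2))} (h : IsCompact F) :
    IsCompact (comb θ N F) :=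
  (isCompact_seg θ).union (Finset.isCompact_biUnion _ fun _ _ => isCompact_dilate h)

lemma norm_le_of_mem_seg {θ : ℝ} {x : EuclideanSpace ℝ (Fin 2)} (hx : x ∈ seg θ) : ‖x‖ ≤ 1 := by
  obtain ⟨t, ht, rfl⟩ := hx
  rw [norm_smul, norm_dir, mul_one, Real.norm_eq_abs]
  exact abs_le.2 ht

section comb

variable {θ : ℝ} {N : ℕ} {F : Set (EuclideanSpace ℝ (Fin 2))} {n : ℤ}
  {x y : EuclideanSpace ℝ (Fin 2)}

lemma abs_inner_dir_copy_le (hF : F ⊆ Metric.closedBall 0 2) (hx : x ∈ copy θ N F n) :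
    |inner ℝ (dir θ) x - (N : ℝ)⁻¹ * n| ≤ (N : ℝ)⁻¹ / 10 := by
  obtain ⟨q, hq, rfl⟩ := hx
  have hq' := mem_closedBall_zero_iff.1 (hF hq)
  have hN : (0 : ℝ) ≤ (N : ℝ)⁻¹ := by positivity
  have h : inner ℝ (dir θ) (ctr θ N n + ((N : ℝ)⁻¹ / 20) • q) - (N : ℝ)⁻¹ * n =
      (N : ℝ)⁻¹ / 20 * inner ℝ (dir θ) q := by
    simp only [ctr, inner_add_right, inner_smul_right, inner_dir_dir, inner_dir_nrm]
    ring
  rw [h, abs_mul, abs_of_nonneg (by positivity : (0 : ℝ) ≤ (N : ℝ)⁻¹ / 20)]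
  nlinarith [abs_inner_dir_le θ q]

lemma abs_inner_nrm_copy_le (hF : F ⊆ Metric.closedBall 0 2) (hx : x ∈ copy θ N F n) :
    |inner ℝ (nrm θ) x - (N : ℝ)⁻¹ / 2| ≤ (N : ℝ)⁻¹ / 10 := by
  obtain ⟨q, hq, rfl⟩ := hx
  have hq' := mem_closedBall_zero_iff.1 (hF hq)
  have hN : (0 : ℝ) ≤ (N : ℝ)⁻¹ := by positivity
  have h : inner ℝ (nrm θ) (ctr θ N n + ((N : ℝ)⁻¹ / 20) • q) - (N : ℝ)⁻¹ / 2 =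
      (N : ℝ)⁻¹ / 20 * inner ℝ (nrm θ) q := by
    simp only [ctr, inner_add_right, inner_smul_right, inner_nrm_dir, inner_nrm_nrm]
    ring
  rw [h, abs_mul, abs_of_nonneg (by positivity : (0 : ℝ) ≤ (N : ℝ)⁻¹ / 20)]
  nlinarith [abs_inner_nrm_le θ q]

lemma inner_nrm_of_mem_seg (hx : x ∈ seg θ) : inner ℝ (nrm θ) x = 0 := by
  obtain ⟨t, -, rfl⟩ := hx
  simp [inner_smul_right, inner_nrm_dir]

lemma inv_natCast_mul_intCast_mem (hN : 1 ≤ N) (hn : n ∈ Finset.Icc (-(N : ℤ)) N) :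
    (N : ℝ)⁻¹ * n ∈ Icc (-1 : ℝ) 1 := by
  have hN0 : (0 : ℝ) < N := by exact_mod_cast hN
  obtain ⟨h1, h2⟩ := Finset.mem_Icc.1 hn
  have h1' : -(N : ℝ) ≤ n := by exact_mod_cast h1
  have h2' : (n : ℝ) ≤ N := by exact_mod_cast h2
  rw [inv_mul_eq_div]
  constructor
  · rw [le_div_iff₀ hN0]; linarith
  · rw [div_le_iff₀ hN0]; linarith

lemma dist_copy_le (hF : F ⊆ Metric.closedBall 0 2) (hx : x ∈ copy θ N F n) :
    dist x (((N : ℝ)⁻¹ * n) • dir θ) ≤ 7 / 10 * (N : ℝ)⁻¹ := by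
  have h1 := abs_inner_dir_copy_le hF hx
  have h2 := abs_inner_nrm_copy_le hF hx
  rw [dist_eq_norm]
  refine (norm_le_abs_inner_add θ _).trans ?_
  simp only [inner_sub_right, inner_smul_right, inner_dir_dir, inner_nrm_dir, mul_one, mul_zero,
    sub_zero]
  have h3 : |inner ℝ (nrm θ) x| ≤ 6 / 10 * (N : ℝ)⁻¹ := by
    rw [abs_le] at h2 ⊢
    constructor <;> linarith [h2.1, h2.2, (by positivity : (0 : ℝ) ≤ (N : ℝ)⁻¹)]
  linarith

/-- The radius is `1 + 7 / 10`. That it is below 2, the length of the base segment, later allows a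
ball of admissible radius to contain the whole set. -/
lemma comb_subset_closedBall (hN : 1 ≤ N) (hF : F ⊆ Metric.closedBall 0 2) :
    comb θ N F ⊆ Metric.closedBall 0 (17 / 10) := by
  rintro x (hx | hx)
  · rw [mem_closedBall_zero_iff]
    linarith [norm_le_of_mem_seg hx]
  · obtain ⟨n, hn, hx⟩ := mem_iUnion₂.1 hx
    have h1 := dist_copy_le hF hx
    have h2 : ‖((N : ℝ)⁻¹ * n) • dir θ‖ ≤ 1 :=
      norm_le_of_mem_seg ⟨_, inv_natCast_mul_intCast_mem hN hn, rfl⟩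
    have h3 : (N : ℝ)⁻¹ ≤ 1 := inv_le_one_of_one_le₀ (by exact_mod_cast hN)
    rw [Metric.mem_closedBall]
    refine (dist_triangle _ _ _).trans ((add_le_add h1 (by simpa using h2)).trans ?_)
    linarith

lemma dist_seg_copy_ge (hF : F ⊆ Metric.closedBall 0 2) (hx : x ∈ copy θ N F n)
    (hy : y ∈ seg θ) : 2 / 5 * (N : ℝ)⁻¹ ≤ dist y x := by
  have h1 := abs_inner_nrm_copy_le hF hx
  have h2 := abs_inner_nrm_le θ (y - x)
  rw [inner_sub_right, inner_nrm_of_mem_seg hy] at h2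
  rw [dist_eq_norm]
  linarith [(abs_le.1 h1).1, (abs_le.1 h2).1]

lemma dist_copy_copy_ge {m : ℤ} (hF : F ⊆ Metric.closedBall 0 2) (hx : x ∈ copy θ N F n)
    (hy : y ∈ copy θ N F m) (hmn : m ≠ n) : 4 / 5 * (N : ℝ)⁻¹ ≤ dist y x := by
  have h1 := abs_le.1 (abs_inner_dir_copy_le hF hx)
  have h2 := abs_le.1 (abs_inner_dir_copy_le hF hy)
  have h3 := abs_le.1 (abs_inner_dir_le θ (y - x))
  have hN : (0 : ℝ) ≤ (N : ℝ)⁻¹ := by positivity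
  rw [inner_sub_right] at h3
  rw [dist_eq_norm]
  rcases lt_or_gt_of_ne hmn with h | h
  · have h4 : (m : ℝ) + 1 ≤ n := by exact_mod_cast h
    linarith [mul_le_mul_of_nonneg_left h4 hN]
  · have h4 : (n : ℝ) + 1 ≤ m := by exact_mod_cast h
    linarith [mul_le_mul_of_nonneg_left h4 hN]

/-- The gaps `2 / (5 N)` to the segment and `4 / (5 N)` to the other copies exceed `1 / (5 N)`. This
locality lets small scales be handled by rescaling a single copy. -/
lemma mem_copy_of_dist_le (hN : 1 ≤ N) (hF : F ⊆ Metric.closedBall 0 2) (hx : x ∈ copy θ N F n)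
    (hy : y ∈ comb θ N F) (hxy : dist y x ≤ (N : ℝ)⁻¹ / 5) : y ∈ copy θ N F n := by
  have hN0 : (0 : ℝ) < (N : ℝ)⁻¹ := inv_pos.2 (by exact_mod_cast hN)
  rcases hy with hy | hy
  · linarith [dist_seg_copy_ge hF hx hy]
  · obtain ⟨m, -, hy⟩ := mem_iUnion₂.1 hy
    by_cases h : m = n
    · exact h ▸ hy
    · linarith [dist_copy_copy_ge hF hx hy h]

end comb

/-! ### Upper regularity of one step -/

section upperRegularity

variable {θ : ℝ} {N : ℕ} {F : Set (EuclideanSpace ℝ (Fin 2))}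

lemma hausdorffMeasure_copy (hN : 1 ≤ N) (n : ℤ) :
    μH[1] (copy θ N F n) = ENNReal.ofReal ((N : ℝ)⁻¹ / 20) * μH[1] F :=
  hausdorffMeasure_dilate _ (div_pos (inv_pos.2 (by exact_mod_cast hN)) (by norm_num)) F

/-- The copies contribute at most `(2 N + 1) * 3 / (20 N) < 1` on top of the segment's 2, so the
bound 3 reproduces itself. -/
lemma hausdorffMeasure_comb_le (hN : 1 ≤ N) (hF : μH[1] F ≤ 3) : μH[1] (comb θ N F) ≤ 3 := by
  have hN' : (1 : ℝ) ≤ N := by exact_mod_cast hN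
  calc μH[1] (comb θ N F)
      ≤ μH[1] (seg θ) + ∑ n ∈ Finset.Icc (-(N : ℤ)) N, μH[1] (copy θ N F n) :=
        (measure_union_le _ _).trans (add_le_add le_rfl (measure_biUnion_finset_le _ _))
    _ ≤ 2 + ∑ _n ∈ Finset.Icc (-(N : ℤ)) N, ENNReal.ofReal ((N : ℝ)⁻¹ / 20) * 3 := by
        rw [hausdorffMeasure_seg]
        gcongr with n
        rw [hausdorffMeasure_copy hN]
        gcongr
    _ = 2 + ENNReal.ofReal ((2 * N + 1) * ((N : ℝ)⁻¹ / 20 * 3)) := by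
        have hc : ((N : ℤ) + 1 - -(N : ℤ)).toNat = 2 * N + 1 := by omega
        rw [Finset.sum_const, Int.card_Icc, hc, nsmul_eq_mul,
          ENNReal.ofReal_mul (by positivity), ENNReal.ofReal_mul (by positivity)]
        congr 2
        · rw [show (2 * (N : ℝ) + 1) = ((2 * N + 1 : ℕ) : ℝ) by push_cast; ring,
            ENNReal.ofReal_natCast]
        · norm_num
    _ ≤ 2 + ENNReal.ofReal 1 := by
        gcongr
        have : (2 * (N : ℝ) + 1) * ((N : ℝ)⁻¹ / 20 * 3) = 3 / 10 + 3 / 20 * (N : ℝ)⁻¹ := by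
          field_simp
          ring
        rw [this]
        linarith [inv_le_one_of_one_le₀ hN']
    _ = 3 := by norm_num

/-- Below `1 / (10 N)` a ball meets either one copy only, where the scale-invariant bound is
inherited, or just the segment. Above it, copies are counted and each is charged its full mass: the
total is at most `2 r + 3 r / 10 + 9 / (50 N)`, and `1 / N ≤ 10 r`. -/
lemma hausdorffMeasure_comb_inter_closedBall_le (hN : 1 ≤ N) (hF : F ⊆ Metric.closedBall 0 2)
    (hF3 : μH[1] F ≤ 3)
    (hF5 : ∀ x r, 0 < r → μH[1] (F ∩ Metric.closedBall x r) ≤ ENNReal.ofReal (5 * r))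
    (x : EuclideanSpace ℝ (Fin 2)) {r : ℝ} (hr : 0 < r) :
    μH[1] (comb θ N F ∩ Metric.closedBall x r) ≤ ENNReal.ofReal (5 * r) := by
  have hρ : (0 : ℝ) < (N : ℝ)⁻¹ := inv_pos.2 (by exact_mod_cast hN)
  rcases lt_or_ge r ((N : ℝ)⁻¹ / 10) with hr' | hr'
  · by_cases h : ∃ n ∈ Finset.Icc (-(N : ℤ)) N, ∃ y ∈ copy θ N F n, y ∈ Metric.closedBall x r
    · obtain ⟨n, hn, y, hy, hyr⟩ := h
      have hsub : comb θ N F ∩ Metric.closedBall x r ⊆ copy θ N F n ∩ Metric.closedBall x r := by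
        rintro w ⟨hw, hwr⟩
        refine ⟨mem_copy_of_dist_le hN hF hy hw ?_, hwr⟩
        have := dist_triangle_right w y x
        rw [Metric.mem_closedBall] at hwr hyr
        linarith
      have hσ : (0 : ℝ) < (N : ℝ)⁻¹ / 20 := by positivity
      refine (measure_mono (hsub.trans (dilate_inter_closedBall_subset _ _ hσ _ _))).trans ?_
      rw [hausdorffMeasure_dilate _ hσ]
      refine (mul_le_mul_right (hF5 _ _ (div_pos hr hσ)) _).trans ?_
      rw [← ENNReal.ofReal_mul hσ.le]
      refine ENNReal.ofReal_le_ofReal (le_of_eq ?_)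
      field_simp
    · have hsub : comb θ N F ∩ Metric.closedBall x r ⊆ seg θ ∩ Metric.closedBall x r := by
        rintro w ⟨hw | hw, hwr⟩
        · exact ⟨hw, hwr⟩
        · obtain ⟨n, hn, hw⟩ := mem_iUnion₂.1 hw
          exact absurd ⟨n, hn, w, hw, hwr⟩ h
      refine (measure_mono hsub).trans ((hausdorffMeasure_seg_inter_closedBall_le _ _ _).trans ?_)
      exact ENNReal.ofReal_le_ofReal (by linarith)
  · set c : ℝ := inner ℝ (dir θ) x
    set J := Finset.Icc ⌈(c - (r + (N : ℝ)⁻¹ / 10)) * N⌉ ⌊(c + (r + (N : ℝ)⁻¹ / 10)) * N⌋ with hJ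
    have hN0 : (0 : ℝ) < N := inv_pos.1 hρ
    have hNN : (N : ℝ)⁻¹ * N = 1 := inv_mul_cancel₀ hN0.ne'
    have hsub : comb θ N F ∩ Metric.closedBall x r ⊆
        (seg θ ∩ Metric.closedBall x r) ∪ ⋃ n ∈ J, copy θ N F n := by
      rintro w ⟨hw | hw, hwr⟩
      · exact Or.inl ⟨hw, hwr⟩
      · obtain ⟨n, hn, hw⟩ := mem_iUnion₂.1 hw
        refine Or.inr (mem_iUnion₂.2 ⟨n, ?_, hw⟩)
        have h1 := abs_le.1 (abs_inner_dir_copy_le hF hw)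
        have h2 := abs_le.1 ((abs_inner_dir_le θ (w - x)).trans
          ((dist_eq_norm _ _).symm.le.trans (Metric.mem_closedBall.1 hwr)))
        rw [inner_sub_right] at h2
        have h3 : (n : ℝ) = ((N : ℝ)⁻¹ * n) * N := by rw [mul_right_comm, hNN, one_mul]
        rw [hJ, Finset.mem_Icc, Int.ceil_le, Int.le_floor, h3]
        constructor <;> refine mul_le_mul_of_nonneg_right ?_ hN0.le <;> linarith [h1.1, h1.2]
    have hcard : (J.card : ℝ) ≤ 2 * (r + (N : ℝ)⁻¹ / 10) * N + 1 := by
      rw [hJ, Int.card_Icc]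
      rcases le_or_gt 0 (⌊(c + (r + (N : ℝ)⁻¹ / 10)) * N⌋ + 1 -
        ⌈(c - (r + (N : ℝ)⁻¹ / 10)) * N⌉) with h | h
      · have h4 : ∀ z : ℤ, 0 ≤ z → ((z.toNat : ℕ) : ℝ) = z := fun z hz => by
          exact_mod_cast congrArg (Int.cast (R := ℝ)) (Int.toNat_of_nonneg hz)
        rw [h4 _ h]
        push_cast
        linarith [Int.floor_le ((c + (r + (N : ℝ)⁻¹ / 10)) * N),
          Int.le_ceil ((c - (r + (N : ℝ)⁻¹ / 10)) * N)]
      · rw [Int.toNat_of_nonpos h.le]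
        push_cast
        positivity
    calc μH[1] (comb θ N F ∩ Metric.closedBall x r)
        ≤ μH[1] (seg θ ∩ Metric.closedBall x r) + ∑ n ∈ J, μH[1] (copy θ N F n) :=
          (measure_mono hsub).trans
            ((measure_union_le _ _).trans (add_le_add le_rfl (measure_biUnion_finset_le _ _)))
      _ ≤ ENNReal.ofReal (2 * r) + ∑ _n ∈ J, ENNReal.ofReal ((N : ℝ)⁻¹ / 20) * 3 := by
          gcongr with n
          · exact hausdorffMeasure_seg_inter_closedBall_le _ _ _
          · rw [hausdorffMeasure_copy hN]
            gcongr
      _ = ENNReal.ofReal (2 * r + J.card * ((N : ℝ)⁻¹ / 20 * 3)) := by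
          rw [Finset.sum_const, nsmul_eq_mul, ENNReal.ofReal_add (by positivity) (by positivity),
            ENNReal.ofReal_mul (by positivity : (0 : ℝ) ≤ J.card),
            ENNReal.ofReal_mul (by positivity : (0 : ℝ) ≤ (N : ℝ)⁻¹ / 20), ENNReal.ofReal_natCast,
            ENNReal.ofReal_ofNat]
      _ ≤ ENNReal.ofReal (5 * r) := by
          refine ENNReal.ofReal_le_ofReal ?_
          have h5 := mul_le_mul_of_nonneg_right hcard
            (by positivity : (0 : ℝ) ≤ (N : ℝ)⁻¹ / 20 * 3)
          have h6 : (2 * (r + (N : ℝ)⁻¹ / 10) * N + 1) * ((N : ℝ)⁻¹ / 20 * 3) =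
              3 / 10 * r + 9 / 50 * (N : ℝ)⁻¹ := by
            field_simp
            ring
          linarith

end upperRegularity

/-! ### Iteration and the limit set -/

/-- The `k`-th approximation of the set built from the directions `θ j, θ (j + 1), …` and the
numbers `N j, N (j + 1), …`. -/
noncomputable def stage (θ : ℕ → ℝ) (N : ℕ → ℕ) : ℕ → ℕ → Set (EuclideanSpace ℝ (Fin 2))
  | 0, _ => ∅
  | k + 1, j => comb (θ j) (N j) (stage θ N k (j + 1))

/-- The union of the sets `stage θ N k j` over all `k`. -/
noncomputable def limitSet (θ : ℕ → ℝ) (N : ℕ → ℕ) (j : ℕ) : Set (EuclideanSpace ℝ (Fin 2)) :=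
  ⋃ k, stage θ N k j

section limitSet

variable {θ : ℕ → ℝ} {N : ℕ → ℕ}

lemma monotone_stage (j : ℕ) : Monotone fun k => stage θ N k j := by
  have h : ∀ k j, stage θ N k j ⊆ stage θ N (k + 1) j := by
    intro k
    induction k with
    | zero => exact fun j => empty_subset _
    | succ k ih => exact fun j => comb_mono (ih (j + 1))
  exact monotone_nat_of_le_succ fun k => h k j

lemma isCompact_stage (k j : ℕ) : IsCompact (stage θ N k j) := by
  induction k generalizing j with
  | zero => exact isCompact_empty
  | succ k ih => exact isCompact_comb (ih (j + 1))

lemma measurableSet_limitSet (j : ℕ) : MeasurableSet (limitSet θ N j) :=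
  MeasurableSet.iUnion fun k => (isCompact_stage k j).measurableSet

lemma limitSet_eq_comb (j : ℕ) :
    limitSet θ N j = comb (θ j) (N j) (limitSet θ N (j + 1)) := by
  apply Subset.antisymm
  · refine iUnion_subset fun k => ?_
    cases k with
    | zero => exact empty_subset _
    | succ k => exact comb_mono (subset_iUnion (fun k => stage θ N k (j + 1)) k)
  · rintro x (hx | hx)
    · exact mem_iUnion.2 ⟨1, Or.inl hx⟩
    · obtain ⟨n, hn, y, hy, rfl⟩ := mem_iUnion₂.1 hx
      obtain ⟨k, hk⟩ := mem_iUnion.1 hy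
      exact mem_iUnion.2 ⟨k + 1, Or.inr (mem_iUnion₂.2 ⟨n, hn, y, hk, rfl⟩)⟩

lemma stage_subset_closedBall (hN : ∀ j, 1 ≤ N j) (k j : ℕ) :
    stage θ N k j ⊆ Metric.closedBall 0 (17 / 10) := by
  induction k generalizing j with
  | zero => exact empty_subset _
  | succ k ih =>
    exact comb_subset_closedBall (hN j)
      ((ih (j + 1)).trans (Metric.closedBall_subset_closedBall (by norm_num)))

lemma limitSet_subset_closedBall (hN : ∀ j, 1 ≤ N j) (j : ℕ) :
    limitSet θ N j ⊆ Metric.closedBall 0 (17 / 10) :=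
  iUnion_subset fun k => stage_subset_closedBall hN k j

lemma limitSet_subset_closedBall_two (hN : ∀ j, 1 ≤ N j) (j : ℕ) :
    limitSet θ N j ⊆ Metric.closedBall 0 2 :=
  (limitSet_subset_closedBall hN j).trans (Metric.closedBall_subset_closedBall (by norm_num))

lemma hausdorffMeasure_stage_le (hN : ∀ j, 1 ≤ N j) (k j : ℕ) : μH[1] (stage θ N k j) ≤ 3 := by
  induction k generalizing j with
  | zero => simp [stage]
  | succ k ih => exact hausdorffMeasure_comb_le (hN j) (ih (j + 1))

lemma hausdorffMeasure_stage_inter_closedBall_le (hN : ∀ j, 1 ≤ N j) (k j : ℕ)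
    (x : EuclideanSpace ℝ (Fin 2)) {r : ℝ} (hr : 0 < r) :
    μH[1] (stage θ N k j ∩ Metric.closedBall x r) ≤ ENNReal.ofReal (5 * r) := by
  induction k generalizing j x r with
  | zero => simp [stage]
  | succ k ih =>
    exact hausdorffMeasure_comb_inter_closedBall_le (hN j)
      ((stage_subset_closedBall hN k (j + 1)).trans
        (Metric.closedBall_subset_closedBall (by norm_num)))
      (hausdorffMeasure_stage_le hN k (j + 1)) (fun x r hr => ih (j + 1) x hr) x hr

/-- The recursive equation of the limit set has no base case, so the bound is proved on the finite
stages and passed on by continuity from below. -/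
lemma hausdorffMeasure_limitSet_inter_closedBall_le (hN : ∀ j, 1 ≤ N j) (j : ℕ)
    (x : EuclideanSpace ℝ (Fin 2)) {r : ℝ} (hr : 0 < r) :
    μH[1] (limitSet θ N j ∩ Metric.closedBall x r) ≤ ENNReal.ofReal (5 * r) := by
  have hm : Monotone fun k => stage θ N k j ∩ Metric.closedBall x r :=
    fun _ _ h => inter_subset_inter_left _ (monotone_stage j h)
  rw [limitSet, iUnion_inter, hm.measure_iUnion]
  exact iSup_le fun k => hausdorffMeasure_stage_inter_closedBall_le hN k j x hr

end limitSet

/-! ### Flat pieces at all places and scales -/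

/-- `F ∩ closedBall z r` contains a subset `G` of a line, of measure at least `κ * r`, such that
the points of `F` that a point `x` of `G` sees in the narrow cone orthogonal to the line, within
distance `δ * r`, all lie in one annulus. -/
def HasFlatPiece (F : Set (EuclideanSpace ℝ (Fin 2))) (z : EuclideanSpace ℝ (Fin 2))
    (r κ δ : ℝ) : Prop :=
  ∃ (θ : ℝ) (a : EuclideanSpace ℝ (Fin 2)) (G : Set (EuclideanSpace ℝ (Fin 2))),
    G ⊆ F ∧ G ⊆ Metric.closedBall z r ∧ G ⊆ range (fun t : ℝ => a + t • dir θ) ∧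
    ENNReal.ofReal (κ * r) ≤ μH[1] G ∧
    ∀ x ∈ G, ∃ ρ : ℝ, 0 < ρ ∧ ∀ y ∈ F, dist y x ≤ δ * r →
      |inner ℝ (dir θ) (y - x)| < 1 / 20 * ‖y - x‖ → ρ / 4 ≤ dist y x ∧ dist y x ≤ ρ

lemma HasFlatPiece.mono {F F' : Set (EuclideanSpace ℝ (Fin 2))}
    {z z' : EuclideanSpace ℝ (Fin 2)} {r κ δ r' κ' δ' : ℝ} (h : HasFlatPiece F z r κ δ)
    (hFF' : F ⊆ F') (hloc : ∀ x ∈ F, ∀ y ∈ F', dist y x ≤ δ * r → y ∈ F)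
    (hball : F ∩ Metric.closedBall z r ⊆ Metric.closedBall z' r') (hκ : κ' * r' ≤ κ * r)
    (hδ : δ' * r' ≤ δ * r) : HasFlatPiece F' z' r' κ' δ' := by
  obtain ⟨θ, a, G, hGF, hGz, hGl, hG, hcone⟩ := h
  refine ⟨θ, a, G, hGF.trans hFF', fun x hx => hball ⟨hGF hx, hGz hx⟩, hGl,
    (ENNReal.ofReal_le_ofReal hκ).trans hG, fun x hx => ?_⟩
  obtain ⟨ρ, hρ, hc⟩ := hcone x hx
  exact ⟨ρ, hρ, fun y hy hyx => hc y (hloc x (hGF hx) y hy (hyx.trans hδ)) (hyx.trans hδ)⟩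

lemma HasFlatPiece.dilate {F : Set (EuclideanSpace ℝ (Fin 2))} {z : EuclideanSpace ℝ (Fin 2)}
    {r κ δ : ℝ} (h : HasFlatPiece F z r κ δ) (b : EuclideanSpace ℝ (Fin 2)) {σ : ℝ}
    (hσ : 0 < σ) : HasFlatPiece (dilate b σ F) (b + σ • z) (σ * r) κ δ := by
  obtain ⟨θ, a, G, hGF, hGz, hGl, hG, hcone⟩ := h
  refine ⟨θ, b + σ • a, _root_.dilate b σ G, dilate_mono hGF, ?_, ?_, ?_, ?_⟩
  · rintro _ ⟨x, hx, rfl⟩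
    rw [Metric.mem_closedBall, dist_dilate _ _ _ hσ]
    exact mul_le_mul_of_nonneg_left (hGz hx) hσ.le
  · rintro _ ⟨x, hx, rfl⟩
    obtain ⟨t, rfl⟩ := hGl hx
    exact ⟨σ * t, by simp only [smul_add, smul_smul, add_assoc]⟩
  · rw [hausdorffMeasure_dilate _ hσ, mul_left_comm, ENNReal.ofReal_mul hσ.le]
    exact mul_le_mul_right hG _
  · rintro _ ⟨x, hx, rfl⟩
    obtain ⟨ρ, hρ, hc⟩ := hcone x hx
    refine ⟨σ * ρ, mul_pos hσ hρ, ?_⟩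
    rintro _ ⟨y, hy, rfl⟩ h1 h2
    simp only [dist_dilate _ _ _ hσ] at h1 ⊢
    have h3 : b + σ • y - (b + σ • x) = σ • (y - x) := by rw [smul_sub]; abel
    simp only [h3, inner_smul_right, norm_smul, abs_mul, Real.norm_eq_abs, abs_of_pos hσ] at h2
    rw [mul_left_comm, mul_le_mul_iff_right₀ hσ] at h1
    rw [mul_left_comm, mul_lt_mul_iff_right₀ hσ] at h2
    obtain ⟨h4, h5⟩ := hc y hy h1 h2
    exact ⟨by nlinarith, by nlinarith⟩

/-- Points of the segment are purely tangential and lie outside the cone. The copies have height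
between `2 / (5 N)` and `3 / (5 N)`, so in the cone their distance is between `2 / (5 N)` and `12 /
(19 N)`; the outer radius `1 / N` serves. -/
lemma hasFlatPiece_comb {θ : ℝ} {N : ℕ} {F : Set (EuclideanSpace ℝ (Fin 2))} (hN : 1 ≤ N)
    (hF : F ⊆ Metric.closedBall 0 2) {z : EuclideanSpace ℝ (Fin 2)} (hz : z ∈ seg θ) {r : ℝ}
    (hr : 0 < r) (hr4 : r ≤ 4) : HasFlatPiece (comb θ N F) z r (1 / 4) 1 := by
  have hρ : (0 : ℝ) < (N : ℝ)⁻¹ := inv_pos.2 (by exact_mod_cast hN)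
  obtain ⟨t, ht, rfl⟩ := hz
  obtain ⟨s, hs1, hs2⟩ : ∃ s : ℝ, Icc s (s + r / 4) ⊆ Icc (-1) 1 ∧
      ∀ x ∈ Icc s (s + r / 4), |x - t| ≤ r := by
    -- The subinterval extends from `t` towards 0, where there is room because `r / 4 ≤ 1`.
    rcases le_total t 0 with h | h
    · exact ⟨t, Icc_subset_Icc ht.1 (by linarith),
        fun x hx => abs_le.2 ⟨by linarith [hx.1], by linarith [hx.2]⟩⟩
    · exact ⟨t - r / 4, Icc_subset_Icc (by linarith) (by linarith [ht.2]),
        fun x hx => abs_le.2 ⟨by linarith [hx.1], by linarith [hx.2]⟩⟩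
  refine ⟨θ, 0, (fun t : ℝ => 0 + t • dir θ) '' Icc s (s + r / 4), ?_, ?_, image_subset_range _ _,
    ?_, ?_⟩
  · simp only [zero_add]
    exact (image_mono hs1).trans seg_subset_comb
  · rintro _ ⟨x, hx, rfl⟩
    simp only [zero_add]
    rw [Metric.mem_closedBall, dist_eq_norm, ← sub_smul, norm_smul, norm_dir, mul_one]
    exact hs2 x hx
  · rw [hausdorffMeasure_line, Real.volume_Icc]
    exact ENNReal.ofReal_le_ofReal (by linarith)
  · rintro _ ⟨x, hx, rfl⟩
    refine ⟨(N : ℝ)⁻¹, hρ, fun y hy _ hcone => ?_⟩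
    simp only [zero_add] at hcone ⊢
    have hxs : x • dir θ ∈ seg θ := ⟨x, hs1 hx, rfl⟩
    rcases hy with hy | hy
    · have h1 := norm_le_abs_inner_add θ (y - x • dir θ)
      rw [inner_sub_right (nrm θ), inner_nrm_of_mem_seg hy, inner_nrm_of_mem_seg hxs, sub_zero,
        abs_zero] at h1
      linarith [abs_nonneg (inner ℝ (dir θ) (y - x • dir θ))]
    · obtain ⟨n, -, hy⟩ := mem_iUnion₂.1 hy
      have h1 := dist_seg_copy_ge hF hy hxs
      have h2 := norm_le_abs_inner_add θ (y - x • dir θ)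
      have h3 := abs_inner_nrm_copy_le hF hy
      rw [inner_sub_right (nrm θ), inner_nrm_of_mem_seg hxs, sub_zero] at h2
      have h4 : |inner ℝ (nrm θ) y| ≤ 6 / 10 * (N : ℝ)⁻¹ := by
        rw [abs_le] at h3 ⊢
        constructor <;> linarith [h3.1, h3.2]
      rw [dist_comm] at h1
      refine ⟨by linarith, ?_⟩
      rw [dist_eq_norm]
      linarith

/-- Induction on the generation of `z`, comparing `r` with `1 / N`. The constants `1 / 60` and `1 /
15` are forced by the intermediate range, at its top end `r = 3 / N`. -/
lemma hasFlatPiece_limitSet {θ : ℕ → ℝ} {N : ℕ → ℕ} (hN : ∀ j, 1 ≤ N j) (j : ℕ)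
    {z : EuclideanSpace ℝ (Fin 2)} (hz : z ∈ limitSet θ N j) {r : ℝ} (hr : 0 < r) (hr4 : r ≤ 4) :
    HasFlatPiece (limitSet θ N j) z r (1 / 60) (1 / 15) := by
  obtain ⟨k, hk⟩ := mem_iUnion.1 hz
  clear hz
  induction k generalizing j z r with
  | zero => exact absurd hk (notMem_empty _)
  | succ k ih =>
    have hF := limitSet_subset_closedBall_two (θ := θ) hN (j + 1)
    have hρ : (0 : ℝ) < (N j : ℝ)⁻¹ := inv_pos.2 (by exact_mod_cast hN j)
    have hρ1 : (N j : ℝ)⁻¹ ≤ 1 := inv_le_one_of_one_le₀ (by exact_mod_cast hN j)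
    rw [limitSet_eq_comb]
    rcases hk with hk | hk
    · exact (hasFlatPiece_comb (hN j) hF hk hr hr4).mono Subset.rfl (fun _ _ _ h _ => h)
        inter_subset_right (by linarith) (by linarith)
    obtain ⟨n, hn, q, hq, rfl⟩ := mem_iUnion₂.1 hk
    have hqF : q ∈ limitSet θ N (j + 1) := mem_iUnion.2 ⟨k, hq⟩
    have hcF : copy (θ j) (N j) (limitSet θ N (j + 1)) n ⊆
        comb (θ j) (N j) (limitSet θ N (j + 1)) := copy_subset_comb hn
    have hσ : (0 : ℝ) < (N j : ℝ)⁻¹ / 20 := by positivity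
    -- Small scales: the ball is magnified by `20 N`, to radius at most 4, and the induction
    -- hypothesis is applied inside the copy.
    rcases le_or_gt r ((N j : ℝ)⁻¹ / 5) with h1 | h1
    · have h2 := (ih (j + 1) (r := r / ((N j : ℝ)⁻¹ / 20)) (div_pos hr hσ)
        (by rw [div_le_iff₀ hσ]; linarith) hq).dilate (ctr (θ j) (N j) n) hσ
      rw [mul_div_cancel₀ _ hσ.ne'] at h2
      exact h2.mono hcF (fun x hx y hy hxy => mem_copy_of_dist_le (hN j) hF hx hy (by linarith))
        inter_subset_right le_rfl le_rfl
    -- Intermediate scales: the ball contains the whole copy, and the base segment of that copy is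
    -- used at the fixed scale 4, that is `1 / (5 N)` after scaling.
    rcases le_or_gt r (3 * (N j : ℝ)⁻¹) with h2 | h2
    · have h3 : HasFlatPiece (limitSet θ N (j + 1)) ((0 : ℝ) • dir (θ (j + 1))) 4 (1 / 4) 1 := by
        rw [limitSet_eq_comb]
        exact hasFlatPiece_comb (hN (j + 1)) (limitSet_subset_closedBall_two hN _)
          ⟨0, by simp, rfl⟩ (by norm_num) le_rfl
      refine (h3.dilate (ctr (θ j) (N j) n) hσ).mono hcF
        (fun x hx y hy hxy => mem_copy_of_dist_le (hN j) hF hx hy (by linarith)) ?_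
        (by linarith) (by linarith)
      rintro _ ⟨⟨y, hy, rfl⟩, -⟩
      have h4 := mem_closedBall_zero_iff.1 (hF hy)
      have h5 := mem_closedBall_zero_iff.1 (hF hqF)
      rw [Metric.mem_closedBall, dist_dilate _ _ _ hσ, dist_eq_norm]
      nlinarith [norm_sub_le y q]
    -- Large scales: the centre moves to the parent segment, by at most `7 / (10 N) < r / 2`, and
    -- the radius is halved.
    · refine (hasFlatPiece_comb (hN j) hF (z := ((N j : ℝ)⁻¹ * n) • dir (θ j))
        ⟨_, inv_natCast_mul_intCast_mem (hN j) hn, rfl⟩ (half_pos hr) (by linarith)).mono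
        Subset.rfl (fun _ _ _ h _ => h) ?_ (by linarith) (by linarith)
      rintro y ⟨-, hy⟩
      have h3 := dist_copy_le (θ := θ j) (N := N j) (n := n)
        (x := ctr (θ j) (N j) n + ((N j : ℝ)⁻¹ / 20) • q) hF ⟨q, hqF, rfl⟩
      rw [Metric.mem_closedBall] at hy ⊢
      linarith [dist_triangle_right y (ctr (θ j) (N j) n + ((N j : ℝ)⁻¹ / 20) • q)
        (((N j : ℝ)⁻¹ * n) • dir (θ j))]

/-! ### Lines as graphs, cones, and the upper energy bound -/

lemma isLipschitzGraph_line (a : EuclideanSpace ℝ (Fin 2)) (θ : ℝ) :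
    ∃ Γ, IsLipschitzGraph 1 1 Γ ∧ range (fun t : ℝ => a + t • dir θ) ⊆ Γ := by
  have hd : dir θ ≠ 0 := norm_ne_zero_iff.1 (by simp [norm_dir])
  set V := Submodule.span ℝ {dir θ}
  refine ⟨_, ⟨V, finrank_span_singleton hd, fun _ => Vᗮ.orthogonalProjectionOnto a,
    (LipschitzWith.const _).weaken zero_le_one, rfl⟩, ?_⟩
  rintro _ ⟨t, rfl⟩
  refine ⟨V.orthogonalProjectionOnto a + ⟨t • dir θ,
    Submodule.smul_mem _ _ (Submodule.mem_span_singleton_self _)⟩, ?_⟩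
  have h := V.starProjection_add_starProjection_orthogonal a
  simp only [Submodule.starProjection_apply] at h
  conv_rhs => rw [← h]
  simp only [Submodule.coe_add]
  abel

lemma abs_inner_dir_lt_of_mem_cone {x y : EuclideanSpace ℝ (Fin 2)} {θ α : ℝ}
    (h : y ∈ cone x (Submodule.span ℝ {nrm θ}) α) :
    |inner ℝ (dir θ) (y - x)| < Real.sin α * ‖y - x‖ := by
  rw [cone, mem_ofPred_eq, dist_eq_norm] at h
  refine lt_of_le_of_lt ?_ h
  rw [Metric.le_infDist ((Submodule.nonempty _).image _)]
  rintro _ ⟨v, hv, rfl⟩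
  obtain ⟨t, rfl⟩ := Submodule.mem_span_singleton.1 hv
  have h1 : inner ℝ (dir θ) (y - x) = inner ℝ (dir θ) (y - (t • nrm θ + x)) := by
    simp only [inner_sub_right, inner_add_right, inner_smul_right, inner_dir_nrm]
    ring
  rw [h1, dist_eq_norm]
  exact abs_inner_dir_le _ _

/-- Scales up to `δ * R` contribute nothing below `ρ / 4`, and beyond it a tail in which `p ≥ 1`
gives `(5 ρ / s) ^ p ≤ 20 ^ p * ρ / (4 s)`. Scales above `δ * R` are controlled by upper regularity
alone. -/
lemma conicalEnergy_le {μ : Measure (EuclideanSpace ℝ (Fin 2))} {x : EuclideanSpace ℝ (Fin 2)}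
    {V : Submodule ℝ (EuclideanSpace ℝ (Fin 2))} {α R δ ρ p : ℝ} (hp : 1 ≤ p) (hR : 0 < R)
    (hδ : 0 < δ) (hρ : 0 < ρ)
    (hμ : ∀ s, 0 < s → μ (Metric.closedBall x s) ≤ ENNReal.ofReal (5 * s))
    (hfar : ∀ s ≤ δ * R, μ (truncatedCone x V α s) ≤ ENNReal.ofReal (5 * ρ))
    (hnear : ∀ s ≤ δ * R, s < ρ / 4 → μ (truncatedCone x V α s) = 0) :
    conicalEnergy 1 p μ x V α R ≤ ENNReal.ofReal (2 * 20 ^ p + 5 ^ p / δ) := by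
  have hp0 : 0 < p := by linarith
  have key : ∀ {m : ℝ≥0∞} {t s : ℝ}, 0 ≤ t → 0 < s → m ≤ ENNReal.ofReal t →
      (m / ENNReal.ofReal s ^ 1) ^ p / ENNReal.ofReal s ≤ ENNReal.ofReal ((t / s) ^ p / s) := by
    intro m t s ht hs hm
    rw [pow_one, ENNReal.ofReal_div_of_pos hs, ← ENNReal.ofReal_rpow_of_nonneg (by positivity)
      hp0.le, ENNReal.ofReal_div_of_pos hs]
    gcongr
  set c : ℝ := 20 ^ p * (ρ / 4) with hc
  have hc0 : 0 < c := by positivity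
  -- Starting at `ρ / 8` keeps the endpoint `ρ / 4` inside the open ray, at the cost of the factor 2
  -- in `2 * 20 ^ p`.
  set g : ℝ → ℝ≥0∞ := (Ioi (ρ / 8)).indicator fun s => ENNReal.ofReal (c * s ^ (-2 : ℝ)) with hg
  have hgint : ∫⁻ s, g s = ENNReal.ofReal (2 * 20 ^ p) := by
    rw [hg, lintegral_indicator measurableSet_Ioi, ← ofReal_integral_eq_lintegral_ofReal]
    · rw [integral_const_mul, integral_Ioi_rpow_of_lt (by norm_num) (by positivity)]
      congr 1
      rw [show (-2 : ℝ) + 1 = -1 by norm_num, Real.rpow_neg_one, hc]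
      field_simp
      norm_num
    · exact (integrableOn_Ioi_rpow_of_lt (by norm_num) (by positivity)).const_mul c
    · filter_upwards [ae_restrict_mem measurableSet_Ioi] with s hs
      have : 0 < s := lt_trans (by positivity) (mem_Ioi.1 hs)
      simp only [Pi.zero_apply]
      positivity
  have hbound : ∀ s ∈ Ioc 0 R, (μ (truncatedCone x V α s) / ENNReal.ofReal s ^ 1) ^ p /
      ENNReal.ofReal s ≤ g s + ENNReal.ofReal (5 ^ p / (δ * R)) := by
    rintro s ⟨hs, hsR⟩
    rcases le_or_gt s (δ * R) with h | h
    · refine le_add_right ?_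
      rcases lt_or_ge s (ρ / 4) with h' | h'
      · rw [hnear s h h', ENNReal.zero_div, ENNReal.zero_rpow_of_pos hp0, ENNReal.zero_div]
        exact zero_le
      · refine (key (by positivity) hs (hfar s h)).trans ?_
        rw [hg, indicator_of_mem (mem_Ioi.2 (by linarith))]
        refine ENNReal.ofReal_le_ofReal ?_
        have h1 : (5 * ρ / s) ^ p ≤ 20 ^ p * (ρ / 4 / s) := by
          rw [show 5 * ρ / s = 20 * (ρ / 4 / s) by field_simp; norm_num,
            Real.mul_rpow (by norm_num) (by positivity)]
          gcongr
          exact Real.rpow_le_self_of_le_one (by positivity) ((div_le_one hs).2 h') hp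
        calc (5 * ρ / s) ^ p / s ≤ 20 ^ p * (ρ / 4 / s) / s := by gcongr
          _ = c * s ^ (-2 : ℝ) := by
            rw [Real.rpow_neg hs.le, Real.rpow_two, hc]
            field_simp
    · refine le_add_left ((key (by positivity) hs
        ((measure_mono inter_subset_right).trans (hμ s hs))).trans ?_)
      rw [mul_div_cancel_right₀ _ hs.ne']
      exact ENNReal.ofReal_le_ofReal (by gcongr)
  calc conicalEnergy 1 p μ x V α R
      ≤ ∫⁻ s in Ioc 0 R, (g s + ENNReal.ofReal (5 ^ p / (δ * R))) :=
        setLIntegral_mono' measurableSet_Ioc hbound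
    _ = (∫⁻ s in Ioc 0 R, g s) + ENNReal.ofReal (5 ^ p / (δ * R)) * ENNReal.ofReal R := by
        rw [lintegral_add_right _ measurable_const, setLIntegral_const, Real.volume_Ioc, sub_zero]
    _ ≤ ENNReal.ofReal (2 * 20 ^ p) + ENNReal.ofReal (5 ^ p / δ) := by
        gcongr
        · exact (setLIntegral_le_lintegral _ _).trans hgint.le
        · rw [← ENNReal.ofReal_mul (by positivity)]
          refine ENNReal.ofReal_le_ofReal (le_of_eq ?_)
          field_simp
    _ = ENNReal.ofReal (2 * 20 ^ p + 5 ^ p / δ) :=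
        (ENNReal.ofReal_add (by positivity) (by positivity)).symm

lemma hausdorffOn_one (E : Set (EuclideanSpace ℝ (Fin 2))) :
    hausdorffOn 1 E = (μH[1]).restrict E := by
  rw [hausdorffOn, Nat.cast_one]

lemma hausdorffOn_one_closedBall (E : Set (EuclideanSpace ℝ (Fin 2)))
    (x : EuclideanSpace ℝ (Fin 2)) (r : ℝ) :
    hausdorffOn 1 E (Metric.closedBall x r) = μH[1] (E ∩ Metric.closedBall x r) := by
  rw [hausdorffOn_one, Measure.restrict_apply Metric.isClosed_closedBall.measurableSet, inter_comm]

lemma support_hausdorffOn_subset (E : Set (EuclideanSpace ℝ (Fin 2))) :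
    (hausdorffOn 1 E).support ⊆ closure E := by
  rw [hausdorffOn_one]
  exact Measure.support_restrict_subset.trans inter_subset_left

/-! ### Regularity, big pieces of graphs and of bounded energy -/

section regularity

variable {θ : ℕ → ℝ} {N : ℕ → ℕ}

lemma lt_four_of_lt_ediam (hN : ∀ j, 1 ≤ N j) {r : ℝ}
    (h : ENNReal.ofReal r < Metric.ediam (limitSet θ N 0)) : r < 4 := by
  have h1 : Metric.ediam (limitSet θ N 0) ≤ ENNReal.ofReal 4 := by
    refine Metric.ediam_le fun x hx y hy => ?_
    rw [edist_dist]
    refine ENNReal.ofReal_le_ofReal ((dist_triangle_right x y 0).trans ?_)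
    have h2 := Metric.mem_closedBall.1 (limitSet_subset_closedBall_two hN 0 hx)
    have h3 := Metric.mem_closedBall.1 (limitSet_subset_closedBall_two hN 0 hy)
    linarith
  exact (ENNReal.ofReal_lt_ofReal_iff (by norm_num)).1 (h.trans_le h1)

lemma le_hausdorffMeasure_limitSet_inter_closedBall (hN : ∀ j, 1 ≤ N j) (j : ℕ)
    {z : EuclideanSpace ℝ (Fin 2)} (hz : z ∈ limitSet θ N j) {r : ℝ} (hr : 0 < r)
    (hr4 : r ≤ 4) :
    ENNReal.ofReal (1 / 60 * r) ≤ μH[1] (limitSet θ N j ∩ Metric.closedBall z r) := by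
  obtain ⟨_, _, G, hGF, hGz, -, hG, -⟩ := hasFlatPiece_limitSet hN j hz hr hr4
  exact hG.trans (measure_mono (subset_inter hGF hGz))

lemma isADRSet_limitSet (hN : ∀ j, 1 ≤ N j) : IsADRSet 1 (limitSet θ N 0) := by
  refine ⟨le_toOuterMeasure_caratheodory _ _ (measurableSet_limitSet 0), 60, by norm_num,
    fun x hx r hr hrd => ?_⟩
  have hr4 := lt_four_of_lt_ediam hN hrd
  rw [hausdorffOn_one_closedBall]
  refine ⟨?_, (hausdorffMeasure_limitSet_inter_closedBall_le hN 0 x hr).trans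
    (ENNReal.ofReal_le_ofReal (by linarith))⟩
  have := le_hausdorffMeasure_limitSet_inter_closedBall hN 0 hx hr hr4.le
  rwa [pow_one, inv_eq_one_div]

lemma hasBPLG_limitSet (hN : ∀ j, 1 ≤ N j) : HasBPLG 1 1 (limitSet θ N 0) := by
  refine ⟨1 / 60, by norm_num, fun x hx r hr hrd => ?_⟩
  obtain ⟨φ, a, G, hGF, hGz, hGl, hG, -⟩ :=
    hasFlatPiece_limitSet hN 0 hx hr (lt_four_of_lt_ediam hN hrd).le
  obtain ⟨Γ, hΓ, hsub⟩ := isLipschitzGraph_line a φ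
  refine ⟨Γ, hΓ, ?_⟩
  rw [pow_one, Nat.cast_one]
  exact hG.trans (measure_mono (subset_inter (subset_inter hGF hGz) (hGl.trans hsub)))

lemma hasBPBE_limitSet (hN : ∀ j, 1 ≤ N j) {p : ℝ} (hp : 1 ≤ p) :
    HasBPBE 1 p (hausdorffOn 1 (limitSet θ N 0)) := by
  set E := limitSet θ N 0
  have hsin : Real.sin (1 / 20) ≤ 1 / 20 := Real.sin_le (by norm_num)
  refine ⟨1 / 20, 1 / 600, 2 * 20 ^ p + 5 ^ p / (1 / 30), by norm_num,
    by linarith [Real.pi_gt_three], by norm_num, by positivity, fun z hz r hr hrd => ?_⟩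
  have hr4 : r < 4 := by
    refine lt_four_of_lt_ediam (θ := θ) hN (hrd.trans_le ?_)
    rw [← Metric.ediam_closure (limitSet θ N 0)]
    exact Metric.ediam_mono (support_hausdorffOn_subset E)
  -- A support point is only known to lie in the closure; passing to a nearby point of the set
  -- halves the flat-piece constants to `1 / 120` and `1 / 30`. Dividing by the upper constant 5
  -- gives `1 / 600`.
  obtain ⟨z', hz', hzz'⟩ := Metric.mem_closure_iff.1 (support_hausdorffOn_subset E hz) (r / 2)
    (half_pos hr)
  have hflat : HasFlatPiece E z r (1 / 120) (1 / 30) := by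
    refine (hasFlatPiece_limitSet hN 0 hz' (half_pos hr) (by linarith)).mono Subset.rfl
      (fun _ _ _ h _ => h) (inter_subset_right.trans
        (Metric.closedBall_subset_closedBall' ?_)) (by linarith) (by linarith)
    rw [dist_comm]
    linarith
  obtain ⟨φ, a, G, hGF, hGz, -, hG, hcone⟩ := hflat
  have hn : nrm φ ≠ 0 := norm_ne_zero_iff.1 (by simp [norm_nrm])
  refine ⟨G, hGz, ?_, Submodule.span ℝ {nrm φ}, by rw [finrank_span_singleton hn], fun x hx => ?_⟩
  · rw [hausdorffOn_one_closedBall, hausdorffOn_one, Measure.restrict_eq_self _ hGF]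
    refine (mul_le_mul_right (hausdorffMeasure_limitSet_inter_closedBall_le hN 0 z hr) _).trans ?_
    rw [← ENNReal.ofReal_mul (by norm_num)]
    exact (ENNReal.ofReal_le_ofReal (by linarith)).trans hG
  · obtain ⟨ρ, hρ, hc⟩ := hcone x hx
    have hcone' : ∀ s ≤ 1 / 30 * r, ∀ y ∈ truncatedCone x (Submodule.span ℝ {nrm φ}) (1 / 20) s,
        y ∈ E → ρ / 4 ≤ dist y x ∧ dist y x ≤ ρ := by
      rintro s hs y ⟨hy, hys⟩ hyE
      exact hc y hyE (hys.trans hs) ((abs_inner_dir_lt_of_mem_cone hy).trans_le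
        (mul_le_mul_of_nonneg_right hsin (norm_nonneg _)))
    have hmeas : ∀ A : Set (EuclideanSpace ℝ (Fin 2)), hausdorffOn 1 E A = μH[1] (A ∩ E) :=
      fun A => by
        rw [hausdorffOn_one, Measure.restrict_apply' (measurableSet_limitSet 0)]
    refine conicalEnergy_le hp hr (by norm_num) hρ (fun s hs => ?_) (fun s hs => ?_)
      (fun s hs hsρ => ?_)
    · rw [hausdorffOn_one_closedBall]
      exact hausdorffMeasure_limitSet_inter_closedBall_le hN 0 x hs
    · rw [hmeas]
      exact (measure_mono (t := E ∩ Metric.closedBall x ρ) fun y hy => ⟨hy.2, (hcone' s hs y hy.1 hy.2).2⟩).trans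
        (hausdorffMeasure_limitSet_inter_closedBall_le hN 0 x hρ)
    · rw [hmeas]
      convert! measure_empty (μ := (μH[1] : Measure (EuclideanSpace ℝ (Fin 2))))
      refine eq_empty_of_forall_notMem fun y hy => ?_
      have h1 := (hcone' s hs y hy.1 hy.2).1
      have h2 := Metric.mem_closedBall.1 hy.1.2
      linarith

lemma subset_support_hausdorffOn_limitSet (hN : ∀ j, 1 ≤ N j) :
    limitSet θ N 0 ⊆ (hausdorffOn 1 (limitSet θ N 0)).support := by
  intro x hx
  rw [Measure.mem_support_iff_forall]
  intro U hU
  obtain ⟨ε, hε, hsub⟩ := Metric.nhds_basis_closedBall.mem_iff.1 hU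
  have h := le_hausdorffMeasure_limitSet_inter_closedBall hN 0 hx (lt_min hε four_pos)
    (min_le_right _ _)
  rw [← hausdorffOn_one_closedBall] at h
  refine lt_of_lt_of_le (ENNReal.ofReal_pos.2 ?_) (h.trans (measure_mono
    ((Metric.closedBall_subset_closedBall (min_le_left _ _)).trans hsub)))
  have := lt_min hε four_pos
  positivity

end regularity

/-! ### Deep generations and their ancestor segments -/

/-- The part of `stage θ N (k + 1) j` that was added last. -/
noncomputable def deepPart (θ : ℕ → ℝ) (N : ℕ → ℕ) : ℕ → ℕ → Set (EuclideanSpace ℝ (Fin 2))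
  | 0, j => seg (θ j)
  | k + 1, j =>
    ⋃ n ∈ Finset.Icc (-(N j : ℤ)) (N j), copy (θ j) (N j) (deepPart θ N k (j + 1)) n

section deepPart

variable {θ : ℕ → ℝ} {N : ℕ → ℕ}

lemma isCompact_deepPart (k j : ℕ) : IsCompact (deepPart θ N k j) := by
  induction k generalizing j with
  | zero => exact isCompact_seg _
  | succ k ih => exact Finset.isCompact_biUnion _ fun _ _ => isCompact_dilate (ih (j + 1))

lemma deepPart_subset_limitSet (k j : ℕ) : deepPart θ N k j ⊆ limitSet θ N j := by
  induction k generalizing j with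
  | zero => exact limitSet_eq_comb (θ := θ) (N := N) j ▸ seg_subset_comb
  | succ k ih =>
    rw [limitSet_eq_comb]
    exact subset_union_of_subset_right (iUnion₂_mono fun _ _ => dilate_mono (ih (j + 1))) _

/-- Each generation multiplies the mass by `(2 N + 1) / (20 N) ≥ 1 / 10`, whatever `N` is; hence the
`N j` can be chosen later at will. -/
lemma hausdorffMeasure_deepPart_ge (hN : ∀ j, 1 ≤ N j) (k j : ℕ) :
    ENNReal.ofReal (2 * (1 / 10) ^ k) ≤ μH[1] (deepPart θ N k j) := by
  induction k generalizing j with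
  | zero => simp [deepPart, hausdorffMeasure_seg]
  | succ k ih =>
    have hN0 : (0 : ℝ) < N j := by exact_mod_cast hN j
    have hF : deepPart θ N k (j + 1) ⊆ Metric.closedBall 0 2 :=
      (deepPart_subset_limitSet k (j + 1)).trans (limitSet_subset_closedBall_two hN _)
    have hdisj : (↑(Finset.Icc (-(N j : ℤ)) (N j)) : Set ℤ).PairwiseDisjoint
        (copy (θ j) (N j) (deepPart θ N k (j + 1))) := by
      intro n _ m _ hnm
      refine disjoint_left.2 fun x hx hx' => ?_
      have h := dist_copy_copy_ge hF hx hx' hnm.symm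
      rw [dist_self] at h
      linarith [inv_pos.2 hN0]
    have hc : ((N j : ℤ) + 1 - -(N j : ℤ)).toNat = 2 * N j + 1 := by omega
    rw [deepPart, measure_biUnion_finset hdisj
      fun n _ => (isCompact_dilate (isCompact_deepPart k (j + 1))).measurableSet]
    simp_rw [hausdorffMeasure_copy (hN j)]
    rw [Finset.sum_const, Int.card_Icc, hc, nsmul_eq_mul]
    refine le_trans ?_ (mul_le_mul_right (mul_le_mul_right (ih (j + 1)) _) _)
    rw [← ENNReal.ofReal_natCast, ← ENNReal.ofReal_mul (by positivity),
      ← ENNReal.ofReal_mul (by positivity)]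
    refine ENNReal.ofReal_le_ofReal ?_
    have h1 : ((2 * N j + 1 : ℕ) : ℝ) * ((N j : ℝ)⁻¹ / 20 * (2 * (1 / 10) ^ k)) =
        2 * (1 / 10) ^ (k + 1) + (N j : ℝ)⁻¹ / 20 * (2 * (1 / 10) ^ k) := by
      push_cast
      field_simp
      ring
    rw [h1]
    exact le_add_of_nonneg_right (by positivity)

/-- In the generation `i` ancestor, the point lies in one of the copies, hence within `7 / (10 N)`
of the ancestor segment, up to the scale `σ`. -/
lemma exists_seg_near_of_mem_deepPart (hN : ∀ j, 1 ≤ N j) {i : ℕ} (k j : ℕ)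
    {x : EuclideanSpace ℝ (Fin 2)} (hx : x ∈ deepPart θ N k j) (hji : j ≤ i) (hik : i < j + k) :
    ∃ (a : EuclideanSpace ℝ (Fin 2)) (σ : ℝ), 0 < σ ∧ σ ≤ 1 ∧
      dilate a σ (seg (θ i)) ⊆ limitSet θ N j ∧
      ∃ t ∈ Icc (-1 : ℝ) 1, dist x (a + σ • t • dir (θ i)) ≤ σ * (N i : ℝ)⁻¹ := by
  induction k generalizing j x with
  | zero => omega
  | succ k ih =>
    have hρ : (0 : ℝ) < (N j : ℝ)⁻¹ := inv_pos.2 (by exact_mod_cast hN j)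
    have hρ1 : (N j : ℝ)⁻¹ ≤ 1 := inv_le_one_of_one_le₀ (by exact_mod_cast hN j)
    obtain ⟨n, hn, hx⟩ := mem_iUnion₂.1 hx
    rcases hji.eq_or_lt with rfl | hji
    · have hF : deepPart θ N k (j + 1) ⊆ Metric.closedBall 0 2 :=
        (deepPart_subset_limitSet k (j + 1)).trans (limitSet_subset_closedBall_two hN _)
      refine ⟨0, 1, one_pos, le_rfl, ?_, _, inv_natCast_mul_intCast_mem (hN j) hn, ?_⟩
      · rw [limitSet_eq_comb]
        simpa [dilate] using seg_subset_comb
      · rw [zero_add, one_smul]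
        linarith [dist_copy_le hF hx]
    · obtain ⟨y, hy, rfl⟩ := hx
      obtain ⟨a, σ, hσ, hσ1, hsub, t, ht, hd⟩ := ih (j + 1) hy hji (by omega)
      have hτ : (0 : ℝ) < (N j : ℝ)⁻¹ / 20 := by positivity
      refine ⟨ctr (θ j) (N j) n + ((N j : ℝ)⁻¹ / 20) • a, (N j : ℝ)⁻¹ / 20 * σ, by positivity,
        mul_le_one₀ (by linarith) hσ.le hσ1, ?_, t, ht, ?_⟩
      · rw [← dilate_dilate, limitSet_eq_comb j]
        exact (dilate_mono hsub).trans (copy_subset_comb hn)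
      · rw [← smul_smul, add_assoc, ← smul_add, dist_dilate _ _ _ hτ, mul_assoc]
        exact mul_le_mul_of_nonneg_left hd hτ.le

end deepPart

/-! ### Lower energy bounds -/

/-- The part of the segment at distance `r / 4` to `r / 2` from the point nearby, on the side with
room, deviates from `V + x` by at most `3 η r / 2`, while its distance to `x` is at least `r / 6`
and `sin α * r / 6 = 2 η r`. -/
lemma le_hausdorffMeasure_truncatedCone_inter {E : Set (EuclideanSpace ℝ (Fin 2))}
    {a x v : EuclideanSpace ℝ (Fin 2)} {V : Submodule ℝ (EuclideanSpace ℝ (Fin 2))}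
    {σ θ t α r η : ℝ} (hσ : 0 < σ) (hE : dilate a σ (seg θ) ⊆ E) (ht : t ∈ Icc (-1 : ℝ) 1)
    (hη : 0 < η) (hηα : η = Real.sin α / 12) (hr : 0 < r) (hrσ : r ≤ σ)
    (hx : dist x (a + σ • t • dir θ) ≤ η * r) (hv : v ∈ V) (hvθ : ‖dir θ - v‖ ≤ η) :
    ENNReal.ofReal (r / 4) ≤ μH[1] (truncatedCone x V α r ∩ E) := by
  obtain ⟨c, hc⟩ : ∃ c : ℝ, ∀ u ∈ Icc c (c + r / 4),
      |u| ≤ σ ∧ r / 4 ≤ |u - σ * t| ∧ |u - σ * t| ≤ r / 2 := by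
    rcases le_total t 0 with h | h
    · refine ⟨σ * t + r / 4, fun u hu => ?_⟩
      have h1 : -σ ≤ σ * t := by nlinarith [ht.1]
      have h2 : σ * t ≤ 0 := mul_nonpos_of_nonneg_of_nonpos hσ.le h
      rw [abs_of_nonneg (a := u - σ * t) (by linarith [hu.1])]
      exact ⟨abs_le.2 ⟨by linarith [hu.1], by linarith [hu.2]⟩, by linarith [hu.1],
        by linarith [hu.2]⟩
    · refine ⟨σ * t - r / 2, fun u hu => ?_⟩
      have h1 : σ * t ≤ σ := by nlinarith [ht.2]
      have h2 : 0 ≤ σ * t := mul_nonneg hσ.le h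
      rw [abs_of_nonpos (a := u - σ * t) (by linarith [hu.2])]
      exact ⟨abs_le.2 ⟨by linarith [hu.1], by linarith [hu.2]⟩, by linarith [hu.2],
        by linarith [hu.1]⟩
  have hsub : (fun u : ℝ => a + u • dir θ) '' Icc c (c + r / 4) ⊆ truncatedCone x V α r ∩ E := by
    rintro _ ⟨u, hu, rfl⟩
    obtain ⟨h1, h2, h3⟩ := hc u hu
    set w := a + σ • t • dir θ with hw
    have hxw : ‖w - x‖ ≤ η * r := by rwa [← dist_eq_norm, dist_comm]
    have hyw : a + u • dir θ - w = (u - σ * t) • dir θ := by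
      rw [hw, sub_smul, mul_smul]
      abel
    have hnyw : ‖a + u • dir θ - w‖ = |u - σ * t| := by
      rw [hyw, norm_smul, norm_dir, mul_one, Real.norm_eq_abs]
    have hη12 : η ≤ 1 / 12 := by linarith [Real.sin_le_one α]
    have hηr : η * r ≤ 1 / 12 * r := mul_le_mul_of_nonneg_right hη12 hr.le
    have hlow : r / 4 - 1 / 12 * r ≤ dist (a + u • dir θ) x := by
      have := norm_sub_norm_le (a + u • dir θ - w) (x - w)
      rw [sub_sub_sub_cancel_right, norm_sub_rev x w] at this
      rw [dist_eq_norm]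
      linarith
    refine ⟨⟨?_, ?_⟩, hE ⟨(u / σ) • dir θ, ⟨u / σ, ?_, rfl⟩, ?_⟩⟩
    · rw [cone, mem_ofPred_eq]
      refine (Metric.infDist_le_dist_of_mem
        (mem_image_of_mem _ (V.smul_mem (u - σ * t) hv))).trans_lt ?_
      have h4 : a + u • dir θ - ((u - σ * t) • v + x) =
          (w - x) + (u - σ * t) • (dir θ - v) := by
        rw [smul_sub, ← hyw]
        abel
      have h5 : ‖(u - σ * t) • (dir θ - v)‖ ≤ r / 2 * η := by
        rw [norm_smul, Real.norm_eq_abs]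
        exact mul_le_mul h3 hvθ (norm_nonneg _) (by positivity)
      rw [dist_eq_norm, h4]
      have h6 : Real.sin α = 12 * η := by linarith
      rw [h6]
      have h7 := mul_le_mul_of_nonneg_left hlow (by positivity : (0 : ℝ) ≤ 12 * η)
      have h8 : 0 < η * r := by positivity
      linarith [norm_add_le (w - x) ((u - σ * t) • (dir θ - v))]
    · rw [Metric.mem_closedBall, dist_eq_norm]
      have := norm_add_le (a + u • dir θ - w) (w - x)
      rw [sub_add_sub_cancel] at this
      linarith
    · rw [mem_Icc, ← abs_le, abs_div, abs_of_pos hσ]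
      exact (div_le_one hσ).2 h1
    · simp only [smul_smul]
      rw [mul_div_cancel₀ _ hσ.ne']
  refine le_trans ?_ (measure_mono hsub)
  rw [hausdorffMeasure_line, Real.volume_Icc]
  exact ENNReal.ofReal_le_ofReal (by linarith)

lemma le_conicalEnergy {μ : Measure (EuclideanSpace ℝ (Fin 2))} {x : EuclideanSpace ℝ (Fin 2)}
    {V : Submodule ℝ (EuclideanSpace ℝ (Fin 2))} {α R p b c : ℝ} (hp : 0 ≤ p) (hb : 0 < b)
    (hc : 0 < c) (hcR : c ≤ R)
    (h : ∀ s ∈ Ioc b c, ENNReal.ofReal (s / 4) ≤ μ (truncatedCone x V α s)) :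
    ENNReal.ofReal ((1 / 4) ^ p * Real.log (c / b)) ≤ conicalEnergy 1 p μ x V α R := by
  rcases le_or_gt c b with hbc | hbc
  · have : Real.log (c / b) ≤ 0 := Real.log_nonpos (by positivity) ((div_le_one hb).2 hbc)
    rw [ENNReal.ofReal_of_nonpos (mul_nonpos_of_nonneg_of_nonpos (by positivity) this)]
    exact zero_le
  have hint : IntegrableOn (fun s : ℝ => s⁻¹) (Ioc b c) := by
    rw [← intervalIntegrable_iff_integrableOn_Ioc_of_le hbc.le]
    refine intervalIntegral.intervalIntegrable_inv (fun s hs => ?_) continuousOn_id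
    rw [uIcc_of_le hbc.le] at hs
    exact (hb.trans_le hs.1).ne'
  calc ENNReal.ofReal ((1 / 4) ^ p * Real.log (c / b))
      = ∫⁻ s in Ioc b c, ENNReal.ofReal ((1 / 4) ^ p * s⁻¹) := by
        rw [← integral_inv_of_pos hb hc, intervalIntegral.integral_of_le hbc.le,
          ← integral_const_mul, ofReal_integral_eq_lintegral_ofReal (hint.const_mul _)]
        filter_upwards [ae_restrict_mem measurableSet_Ioc] with s hs
        have : 0 < s := hb.trans hs.1
        simp only [Pi.zero_apply]
        positivity
    _ ≤ ∫⁻ s in Ioc b c, (μ (truncatedCone x V α s) / ENNReal.ofReal s ^ 1) ^ p /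
          ENNReal.ofReal s := by
        refine setLIntegral_mono' measurableSet_Ioc fun s hs => ?_
        have hs0 : 0 < s := hb.trans hs.1
        rw [← div_eq_mul_inv, ENNReal.ofReal_div_of_pos hs0,
          ← ENNReal.ofReal_rpow_of_nonneg (by norm_num) hp,
          show (1 / 4 : ℝ) = s / 4 / s by field_simp, ENNReal.ofReal_div_of_pos hs0, pow_one]
        gcongr
        exact h s hs
    _ ≤ conicalEnergy 1 p μ x V α R :=
        lintegral_mono_set (Ioc_subset_Ioc hb.le hcR)

lemma exists_unit_mem {V : Submodule ℝ (EuclideanSpace ℝ (Fin 2))}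
    (hV : Module.finrank ℝ V + 1 = 2) : ∃ φ : ℝ, dir φ ∈ V := by
  have : Nontrivial V := Module.nontrivial_of_finrank_pos (R := ℝ) (by omega)
  obtain ⟨v, hv⟩ := exists_ne (0 : V)
  have hv' : ‖(v : EuclideanSpace ℝ (Fin 2))‖ ≠ 0 := by simpa using hv
  obtain ⟨φ, hφ⟩ := exists_dir_eq
    (v := ‖(v : EuclideanSpace ℝ (Fin 2))‖⁻¹ • (v : EuclideanSpace ℝ (Fin 2)))
    (by rw [norm_smul, norm_inv, norm_norm, inv_mul_cancel₀ hv'])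
  exact ⟨φ, hφ ▸ V.smul_mem _ v.2⟩

/-! ### Choice of directions and numbers of copies -/

/-- The steps of `√i` shrink, yet from `j` to `100 j` it grows by `9 √j > 2 π`. With `ψ` the angle
congruent to `φ` in `[√j, √j + 2 π)`, the index `⌊ψ ^ 2⌋` misses `ψ` by at most `1 / √j`. -/
lemma exists_sqrt_near (φ : ℝ) {j : ℕ} (hj : 1 ≤ j) :
    ∃ i, j ≤ i ∧ i < 100 * j ∧ ‖dir √i - dir φ‖ ≤ 2 / √j := by
  have hj1 : (1 : ℝ) ≤ √j := Real.one_le_sqrt.2 (by exact_mod_cast hj)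
  set ψ := toIcoMod Real.two_pi_pos (√j) φ with hψ
  obtain ⟨h1, h2⟩ := toIcoMod_mem_Ico Real.two_pi_pos (√j) φ
  rw [← hψ] at h1 h2
  have hdir : dir φ = dir ψ := by
    have h : φ = ψ + toIcoDiv Real.two_pi_pos (√j) φ * (2 * Real.pi) := by
      rw [← zsmul_eq_mul, hψ, toIcoMod_add_toIcoDiv_zsmul]
    rw [h, dir, dir, Real.cos_add_int_mul_two_pi, Real.sin_add_int_mul_two_pi]
  have hψ0 : 0 < ψ := by linarith
  have hsq : √(j : ℝ) ^ 2 = j := Real.sq_sqrt (Nat.cast_nonneg j)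
  have hfl : (⌊ψ ^ 2⌋₊ : ℝ) ≤ ψ ^ 2 := Nat.floor_le (by positivity)
  have hfl' : ψ ^ 2 < ⌊ψ ^ 2⌋₊ + 1 := Nat.lt_floor_add_one _
  refine ⟨⌊ψ ^ 2⌋₊, ?_, ?_, ?_⟩
  · refine Nat.le_floor ?_
    rw [← hsq]
    gcongr
  · have h3 : ψ < 8 * √j := by linarith [Real.pi_lt_d2]
    have h4 : ψ ^ 2 < (8 * √j) ^ 2 := by gcongr
    have h5 : (⌊ψ ^ 2⌋₊ : ℝ) < 100 * j := by nlinarith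
    exact_mod_cast h5
  · rw [hdir]
    refine (norm_dir_sub_dir_le _ _).trans ?_
    have h3 : √(⌊ψ ^ 2⌋₊ : ℝ) ≤ ψ := by
      rw [Real.sqrt_le_left hψ0.le]
      exact hfl
    have h4 : √(⌊ψ ^ 2⌋₊ : ℝ) ^ 2 = ⌊ψ ^ 2⌋₊ := Real.sq_sqrt (Nat.cast_nonneg _)
    have h5 := Real.sqrt_nonneg (⌊ψ ^ 2⌋₊ : ℝ)
    rw [abs_sub_comm, abs_of_nonneg (by linarith), le_div_iff₀ (by linarith)]
    nlinarith

/-- The number of copies at the `j`-th stage. -/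
noncomputable def copyNumber (j : ℕ) : ℕ := ⌈Real.exp ((j + 1) * 10 ^ (100 * j))⌉₊

lemma one_le_copyNumber (j : ℕ) : 1 ≤ copyNumber j :=
  Nat.one_le_ceil_iff.2 (Real.exp_pos _)

lemma le_log_copyNumber {i j : ℕ} (hij : j ≤ i) :
    ((j : ℝ) + 1) * 10 ^ (100 * j) ≤ Real.log (copyNumber i) := by
  rw [Real.le_log_iff_exp_le (by exact_mod_cast one_le_copyNumber i)]
  refine le_trans (Real.exp_le_exp.2 ?_) (Nat.le_ceil _)
  gcongr
  norm_num

/-- The ancestor segment almost parallel to `V` is seen at all scales between `σ / (η N i)` and `σ`.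
The bound is uniform in `V`, so measurability of the choice of directions plays no role. -/
lemma le_conicalEnergy_of_mem_deepPart {α p η : ℝ} (hp : 1 ≤ p) (hη : 0 < η)
    (hηα : η = Real.sin α / 12) {j : ℕ} (hj : 1 ≤ j) (hjη : 2 / √j ≤ η)
    {x : EuclideanSpace ℝ (Fin 2)} (hx : x ∈ deepPart (fun i => √i) copyNumber (100 * j) 0)
    {V : Submodule ℝ (EuclideanSpace ℝ (Fin 2))} (hV : Module.finrank ℝ V + 1 = 2) {R : ℝ}
    (hR : 1 ≤ R) :
    ENNReal.ofReal ((1 / 4) ^ p * (Real.log η + (j + 1) * 10 ^ (100 * j))) ≤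
      conicalEnergy 1 p (hausdorffOn 1 (limitSet (fun i => √i) copyNumber 0)) x V α R := by
  obtain ⟨φ, hφ⟩ := exists_unit_mem hV
  obtain ⟨i, hji, hij, hd⟩ := exists_sqrt_near φ hj
  obtain ⟨a, σ, hσ, hσ1, hsub, t, ht, hxt⟩ :=
    exists_seg_near_of_mem_deepPart one_le_copyNumber _ _ hx (zero_le (a := i)) (by omega)
  have hN : (0 : ℝ) < copyNumber i := by exact_mod_cast one_le_copyNumber i
  have hb : 0 < σ * (copyNumber i : ℝ)⁻¹ / η := by positivity
  have hlog : Real.log (σ / (σ * (copyNumber i : ℝ)⁻¹ / η)) =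
      Real.log η + Real.log (copyNumber i) := by
    rw [← Real.log_mul hη.ne' hN.ne']
    congr 1
    field_simp
  refine le_trans ?_ (le_conicalEnergy (by linarith) hb hσ (hσ1.trans hR) fun s hs => ?_)
  · rw [hlog]
    refine ENNReal.ofReal_le_ofReal (mul_le_mul_of_nonneg_left ?_ (by positivity))
    linarith [le_log_copyNumber hji]
  · rw [hausdorffOn_one, Measure.restrict_apply' (measurableSet_limitSet 0)]
    refine le_hausdorffMeasure_truncatedCone_inter hσ hsub ht hη hηα (hb.trans hs.1) hs.2
      (hxt.trans ?_) hφ (hd.trans hjη)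
    have := (div_lt_iff₀ hη).1 hs.1
    linarith

/-! ### Failure of bounded mean energy -/

lemma lt_ediam_support {θ : ℕ → ℝ} {N : ℕ → ℕ} (hN : ∀ j, 1 ≤ N j) {r : ℝ} (hr : r < 2) :
    ENNReal.ofReal r < Metric.ediam (hausdorffOn 1 (limitSet θ N 0)).support := by
  have hmem : ∀ t ∈ Icc (-1 : ℝ) 1, t • dir (θ 0) ∈ limitSet θ N 0 := fun t ht => by
    rw [limitSet_eq_comb]
    exact seg_subset_comb ⟨t, ht, rfl⟩
  refine lt_of_lt_of_le ?_ (Metric.edist_le_ediam_of_mem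
    (subset_support_hausdorffOn_limitSet hN (hmem 1 (by norm_num)))
    (subset_support_hausdorffOn_limitSet hN (hmem (-1) (by norm_num))))
  rw [edist_dist, dist_eq_norm, ← sub_smul, norm_smul, norm_dir]
  rw [ENNReal.ofReal_lt_ofReal_iff (by norm_num)]
  norm_num
  exact hr

lemma not_hasBME_limitSet {p : ℝ} (hp : 1 ≤ p) :
    ¬ HasBME 1 p (hausdorffOn 1 (limitSet (fun i => √i) copyNumber 0)) := by
  rintro ⟨α, M, hα, hα2, hM, V, hV, hbound⟩
  set E := limitSet (fun i => √i) copyNumber 0 with hE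
  have hN := one_le_copyNumber
  have hsupp : E ⊆ (hausdorffOn 1 E).support := subset_support_hausdorffOn_limitSet hN
  obtain ⟨η, hηα⟩ : ∃ η, η = Real.sin α / 12 := ⟨_, rfl⟩
  have hη : 0 < η := by
    have := Real.sin_pos_of_pos_of_lt_pi hα (by linarith)
    rw [hηα]
    positivity
  have h0 : (0 : EuclideanSpace ℝ (Fin 2)) ∈ E := by
    rw [hE, limitSet_eq_comb]
    exact seg_subset_comb ⟨0, by norm_num, zero_smul _ _⟩
  have hc : (0 : ℝ) < 2 * (1 / 4) ^ p := by positivity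
  -- The last term produces the contradiction: the ball has mass at most `5 * (19 / 10)`, less than
  -- 10, and `|log η|` absorbs the negative error.
  obtain ⟨j, hj⟩ := exists_nat_ge (max 1 (max ((2 / η) ^ 2)
    (10 * M / (2 * (1 / 4) ^ p) + |Real.log η|)))
  obtain ⟨hj1, hj⟩ := max_le_iff.1 hj
  obtain ⟨hj2, hj3⟩ := max_le_iff.1 hj
  have hjη : 2 / √j ≤ η := by
    have h1 : 2 / η ≤ √j := Real.le_sqrt_of_sq_le hj2
    rw [div_le_iff₀ hη] at h1
    rw [div_le_iff₀ (Real.sqrt_pos.2 (by linarith))]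
    linarith
  set D := deepPart (fun i => √i) copyNumber (100 * j) 0
  have hDE : D ⊆ E := deepPart_subset_limitSet _ _
  -- The radius `19 / 10` lies between `17 / 10`, which covers the set, and 2, a lower bound for the
  -- diameter.
  have hDball : D ⊆ Metric.closedBall 0 (19 / 10) :=
    hDE.trans ((limitSet_subset_closedBall hN 0).trans
      (Metric.closedBall_subset_closedBall (by norm_num)))
  set L : ℝ := (1 / 4) ^ p * (Real.log η + (j + 1) * 10 ^ (100 * j))
  have hlow : ENNReal.ofReal (L * (2 * (1 / 10) ^ (100 * j))) ≤
      ∫⁻ x in Metric.closedBall 0 (19 / 10), conicalEnergy 1 p (hausdorffOn 1 E) x (V x) α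
        (19 / 10) ∂(hausdorffOn 1 E) :=
    calc ENNReal.ofReal (L * (2 * (1 / 10) ^ (100 * j)))
        = ENNReal.ofReal L * ENNReal.ofReal (2 * (1 / 10) ^ (100 * j)) :=
          ENNReal.ofReal_mul' (by positivity)
      _ ≤ ENNReal.ofReal L * hausdorffOn 1 E D := by
          rw [hausdorffOn_one, Measure.restrict_eq_self _ hDE]
          gcongr
          exact hausdorffMeasure_deepPart_ge hN _ _
      _ = ∫⁻ _x in D, ENNReal.ofReal L ∂(hausdorffOn 1 E) := (setLIntegral_const _ _).symm
      _ ≤ ∫⁻ x in D, conicalEnergy 1 p (hausdorffOn 1 E) x (V x) α (19 / 10)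
            ∂(hausdorffOn 1 E) :=
          setLIntegral_mono' (isCompact_deepPart _ _).measurableSet fun x hx =>
            le_conicalEnergy_of_mem_deepPart hp hη hηα (by exact_mod_cast hj1) hjη hx
              (hV x (hsupp (hDE hx))) (by norm_num)
      _ ≤ _ := lintegral_mono_set hDball
  have hup := hlow.trans (hbound 0 (hsupp h0) (19 / 10) (by norm_num)
    (lt_ediam_support hN (by norm_num)))
  rw [hausdorffOn_one_closedBall] at hup
  have hup' := hup.trans (mul_le_mul_right
    (hausdorffMeasure_limitSet_inter_closedBall_le hN 0 0 (by norm_num)) _)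
  rw [← ENNReal.ofReal_mul hM.le, ENNReal.ofReal_le_ofReal_iff (by positivity)] at hup'
  have hpow : (10 : ℝ) ^ (100 * j) * (1 / 10) ^ (100 * j) = 1 := by
    rw [← mul_pow]
    norm_num
  have hL : L * (2 * (1 / 10) ^ (100 * j)) =
      2 * (1 / 4) ^ p * ((j + 1) + Real.log η * (1 / 10) ^ (100 * j)) := by
    linear_combination 2 * (1 / 4) ^ p * ((j : ℝ) + 1) * hpow
  have hlogη : -|Real.log η| ≤ Real.log η * (1 / 10) ^ (100 * j) := by
    have h1 : |Real.log η * (1 / 10) ^ (100 * j)| ≤ |Real.log η| := by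
      rw [abs_mul, abs_of_nonneg (a := (1 / 10 : ℝ) ^ (100 * j)) (by positivity)]
      exact mul_le_of_le_one_right (abs_nonneg _) (pow_le_one₀ (by norm_num) (by norm_num))
    exact (abs_le.1 h1).1
  rw [hL] at hup'
  have h1 : 10 * M / (2 * (1 / 4) ^ p) ≤ (j + 1) + Real.log η * (1 / 10) ^ (100 * j) - 1 := by
    linarith
  rw [div_le_iff₀ hc] at h1
  linarith

theorem mainTheorem1 :
    ∃ E : Set (EuclideanSpace ℝ (Fin 2)),
      IsADRSet 1 E ∧ HasBPLG 1 1 E ∧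
        ∀ p : ℝ, 1 ≤ p →
          HasBPBE 1 p (hausdorffOn 1 E) ∧ ¬ HasBME 1 p (hausdorffOn 1 E) :=
  ⟨limitSet (fun i => √i) copyNumber 0, isADRSet_limitSet one_le_copyNumber,
    hasBPLG_limitSet one_le_copyNumber, fun _ hp =>
      ⟨hasBPBE_limitSet one_le_copyNumber hp, not_hasBME_limitSet hp⟩⟩
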